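/- Let $k<n$ be positive integers. Let $\mathrm{Gr}(k,n)$ be the set of $k$-dimensional linear subspaces of $\mathbb{R}^n$ and $\mathrm{Graff}(k,n)$ the set of $k$-dimensional affine subspaces $\mathbb{A}+b$ of $\mathbb{R}^n$ ($\mathbb{A}\in\mathrm{Gr}(k,n)$, $b\in\mathbb{R}^n$). A real algebraic variety is a separated topological space with a sheaf of real-valued functions that has a finite cover by open subsets isomorphic to Zariski closed subsets of some $\mathbb{R}^m$ with their regular functions (locally quotients of polynomials with nowhere vanishing denominator); it is nonsingular if all its local rings are regular. $\mathrm{Gr}(k,n)$ and $\mathrm{Graff}(k,n)$ carry the Zariski topology, the regular functions and the manifold topology glued from their standard charts: for each $k$-element set $I$ of rows, the subspaces with a basis matrix $X\in\mathbb{R}^{n\times k}$ whose $I$-rows form the identity matrix (with, for $\mathrm{Graff}(k,n)$, a displacement vector $y\in\mathbb{R}^n$ whose $I$-entries vanish) are parametrized by the remaining rows of $X$ (of $[X,y]$), i.e. by $\mathbb{R}^{(n-k)k}$ (by $\mathbb{R}^{(n-k)(k+1)}$). Identify $\mathbb{R}^n$ with $E_n=\{x\in\mathbb{R}^{n+1}:x_{n+1}=0\}$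 and let $e_{n+1}=(0,\dots,0,1)^{\mathsf T}\in\mathbb{R}^{n+1}$. Then: (i) $\mathrm{Graff}(k,n)$ is an irreducible nonsingular real algebraic variety. (ii) The map $$j:\mathrm{Graff}(k,n)\to\mathrm{Gr}(k+1,n+1),\qquad \mathbb{A}+b\mapsto\operatorname{span}(\mathbb{A}\cup\{b+e_{n+1}\}),$$ is well defined and is an embedding, i.e. an isomorphism of varieties onto its image $X$ with the structure induced from $\mathrm{Gr}(k+1,n+1)$, and a homeomorphism onto $X$ in the manifold topologies. The image $X$ is open and dense in $\mathrm{Gr}(k+1,n+1)$ in both the Zariski and the manifold topologies. (iii) The complement $X^c$ of $X$ in $\mathrm{Gr}(k+1,n+1)$ consists of the $(k+1)$-dimensional subspaces contained in $E_n$, and the inclusion $\mathbb{R}^n\cong E_n\subseteq\mathbb{R}^{n+1}$ induces an isomorphism of varieties from $\mathrm{Gr}(k+1,n)$ onto $X^c$ with its induced structure. So $\mathrm{Gr}(k+1,n+1)$ is the disjoint union of $X\cong\mathrm{Graff}(k,n)$ and $X^c\cong\mathrm{Gr}(k+1,n)$. -/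

import Mathlib

open scoped Topology

/-! ### Real algebraic varieties as spaces with functions -/

/-- A topological space with a sheaf of rings of real-valued functions. `Regular U f` means that
the restriction of `f` to the open set `U` is a section of the sheaf; it only depends on
the values of `f` on `U`, and is only meaningful for open `U`. -/
structure SpaceWithFunctions (X : Type*) where
  top : TopologicalSpace X
  Regular : Set X → (X → ℝ) → Prop
  congr : ∀ {U : Set X} {f g : X → ℝ}, Set.EqOn f g U → Regular U f → Regular U g
  mono : ∀ {U V : Set X} {f : X → ℝ}, IsOpen[top] U → IsOpen[top] V → V ⊆ U →
    Regular U f → Regular V f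
  glue : ∀ {U : Set X} {f : X → ℝ}, IsOpen[top] U →
    (∀ x ∈ U, ∃ V : Set X, IsOpen[top] V ∧ x ∈ V ∧ V ⊆ U ∧ Regular V f) → Regular U f
  const : ∀ {U : Set X} (c : ℝ), IsOpen[top] U → Regular U (fun _ => c)
  add : ∀ {U : Set X} {f g : X → ℝ}, IsOpen[top] U → Regular U f → Regular U g →
    Regular U (f + g)
  mul : ∀ {U : Set X} {f g : X → ℝ}, IsOpen[top] U → Regular U f → Regular U g →
    Regular U (f * g)

/-- The Zariski topology on `ℝ^σ`: the closed sets are the zero loci of ideals of polynomials. -/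
def zariskiTopology (σ : Type*) : TopologicalSpace (σ → ℝ) :=
  TopologicalSpace.ofClosed
    (Set.range fun I : Ideal (MvPolynomial σ ℝ) => MvPolynomial.zeroLocus ℝ I)
    ⟨⊤, by simp⟩
    (by
      intro A hA
      refine ⟨sSup {I | MvPolynomial.zeroLocus ℝ I ∈ A}, ?_⟩
      apply Set.Subset.antisymm
      · intro x hx Z hZ
        obtain ⟨I, rfl⟩ := hA hZ
        intro p hp
        exact hx p (le_sSup (a := I) hZ hp)
      · intro x hx
        have h : sSup {I : Ideal (MvPolynomial σ ℝ) | MvPolynomial.zeroLocus ℝ I ∈ A} ≤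
            RingHom.ker (MvPolynomial.aeval x : MvPolynomial σ ℝ →ₐ[ℝ] ℝ) :=
          sSup_le fun I hI p hp => hx _ hI p hp
        exact fun p hp => h hp)
    (by
      rintro _ ⟨I, rfl⟩ _ ⟨J, rfl⟩
      refine ⟨I * J, ?_⟩
      apply Set.Subset.antisymm
      · intro x hx
        by_contra hcon
        simp only [Set.mem_union, MvPolynomial.mem_zeroLocus_iff, not_or, not_forall] at hcon
        obtain ⟨⟨p, hp, hp0⟩, ⟨q, hq, hq0⟩⟩ := hcon
        have h := hx (p * q) (Ideal.mul_mem_mul hp hq)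
        rw [map_mul] at h
        exact (mul_ne_zero hp0 hq0) h
      · exact Set.union_subset (MvPolynomial.zeroLocus_anti_mono Ideal.mul_le_left)
          (MvPolynomial.zeroLocus_anti_mono Ideal.mul_le_right))

/-- The affine space `ℝ^σ` with its Zariski topology; a function is regular on an open set if
locally it is a quotient of two polynomials with nowhere vanishing denominator. -/
def affineSpace (σ : Type*) : SpaceWithFunctions (σ → ℝ) where
  top := zariskiTopology σ
  Regular U f := ∀ a ∈ U, ∃ V : Set (σ → ℝ), IsOpen[zariskiTopology σ] V ∧ a ∈ V ∧ V ⊆ U ∧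
    ∃ p q : MvPolynomial σ ℝ, ∀ z ∈ V,
      MvPolynomial.eval z q ≠ 0 ∧ f z = MvPolynomial.eval z p / MvPolynomial.eval z q
  congr h hf a ha := by
    obtain ⟨V, hV, haV, hVU, p, q, hpq⟩ := hf a ha
    exact ⟨V, hV, haV, hVU, p, q, fun z hz => ⟨(hpq z hz).1, (h (hVU hz)) ▸ (hpq z hz).2⟩⟩
  mono {U V f} _ hV hVU hf a ha := by
    obtain ⟨W, hW, haW, -, p, q, hpq⟩ := hf a (hVU ha)
    exact ⟨W ∩ V, @IsOpen.inter _ (zariskiTopology σ) W V hW hV, ⟨haW, ha⟩,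
      Set.inter_subset_right, p, q, fun z hz => hpq z hz.1⟩
  glue {U f} _ h a ha := by
    obtain ⟨V, _, haV, hVU, hf⟩ := h a ha
    obtain ⟨W, hW, haW, hWV, hpq⟩ := hf a haV
    exact ⟨W, hW, haW, hWV.trans hVU, hpq⟩
  const {U} c hU a ha := ⟨U, hU, ha, subset_rfl, MvPolynomial.C c, 1, by simp⟩
  add {U f g} _ hf hg a ha := by
    obtain ⟨V, hV, haV, hVU, p, q, hpq⟩ := hf a ha
    obtain ⟨W, hW, haW, -, r, s, hrs⟩ := hg a ha
    refine ⟨V ∩ W, @IsOpen.inter _ (zariskiTopology σ) V W hV hW, ⟨haV, haW⟩,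
      Set.inter_subset_left.trans hVU, p * s + q * r, q * s, fun z hz => ?_⟩
    have h1 := hpq z hz.1
    have h2 := hrs z hz.2
    refine ⟨by simpa using ⟨h1.1, h2.1⟩, ?_⟩
    rw [Pi.add_apply, h1.2, h2.2, div_add_div _ _ h1.1 h2.1]
    simp
  mul {U f g} _ hf hg a ha := by
    obtain ⟨V, hV, haV, hVU, p, q, hpq⟩ := hf a ha
    obtain ⟨W, hW, haW, -, r, s, hrs⟩ := hg a ha
    refine ⟨V ∩ W, @IsOpen.inter _ (zariskiTopology σ) V W hV hW, ⟨haV, haW⟩,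
      Set.inter_subset_left.trans hVU, p * r, q * s, fun z hz => ?_⟩
    have h1 := hpq z hz.1
    have h2 := hrs z hz.2
    refine ⟨by simpa using ⟨h1.1, h2.1⟩, ?_⟩
    rw [Pi.mul_apply, h1.2, h2.2, div_mul_div_comm]
    simp

namespace SpaceWithFunctions

variable {X Y : Type*}

/-- The structure induced on a subset: the subspace topology, with the functions that locally
extend to regular functions of the ambient space. -/
def induced (T : SpaceWithFunctions X) (S : Set X) : SpaceWithFunctions S where
  top := TopologicalSpace.induced Subtype.val T.top
  Regular U f := ∀ x ∈ U, ∃ V : Set X, IsOpen[T.top] V ∧ (x : X) ∈ V ∧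
    ∃ g : X → ℝ, T.Regular V g ∧ ∀ y ∈ U, (y : X) ∈ V → f y = g y
  congr h hf x hx := by
    obtain ⟨V, hV, hxV, g, hg, hfg⟩ := hf x hx
    exact ⟨V, hV, hxV, g, hg, fun y hy hyV => (h hy) ▸ hfg y hy hyV⟩
  mono _ _ hVU hf x hx := by
    obtain ⟨V, hV, hxV, g, hg, hfg⟩ := hf x (hVU hx)
    exact ⟨V, hV, hxV, g, hg, fun y hy hyV => hfg y (hVU hy) hyV⟩
  glue {U f} _ h x hx := by
    obtain ⟨_, ⟨W', hW', rfl⟩, hxW, _, hf⟩ := h x hx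
    obtain ⟨V, hV, hxV, g, hg, hfg⟩ := hf x hxW
    have hVW : IsOpen[T.top] (V ∩ W') := @IsOpen.inter _ T.top V W' hV hW'
    exact ⟨V ∩ W', hVW, ⟨hxV, hxW⟩, g, T.mono hV hVW Set.inter_subset_left hg,
      fun y _ hyV => hfg y hyV.2 hyV.1⟩
  const c _ x _ := ⟨Set.univ, @isOpen_univ _ T.top, Set.mem_univ _, fun _ => c,
    T.const c (@isOpen_univ _ T.top), fun _ _ _ => rfl⟩
  add {U f₁ f₂} _ h₁ h₂ x hx := by
    obtain ⟨V, hV, hxV, g, hg, hfg⟩ := h₁ x hx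
    obtain ⟨W, hW, hxW, g', hg', hfg'⟩ := h₂ x hx
    have hVW : IsOpen[T.top] (V ∩ W) := @IsOpen.inter _ T.top V W hV hW
    refine ⟨V ∩ W, hVW, ⟨hxV, hxW⟩, g + g',
      T.add hVW (T.mono hV hVW Set.inter_subset_left hg)
        (T.mono hW hVW Set.inter_subset_right hg'), fun y hy hyV => ?_⟩
    rw [Pi.add_apply, Pi.add_apply, hfg y hy hyV.1, hfg' y hy hyV.2]
  mul {U f₁ f₂} _ h₁ h₂ x hx := by
    obtain ⟨V, hV, hxV, g, hg, hfg⟩ := h₁ x hx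
    obtain ⟨W, hW, hxW, g', hg', hfg'⟩ := h₂ x hx
    have hVW : IsOpen[T.top] (V ∩ W) := @IsOpen.inter _ T.top V W hV hW
    refine ⟨V ∩ W, hVW, ⟨hxV, hxW⟩, g * g',
      T.mul hVW (T.mono hV hVW Set.inter_subset_left hg)
        (T.mono hW hVW Set.inter_subset_right hg'), fun y hy hyV => ?_⟩
    rw [Pi.mul_apply, Pi.mul_apply, hfg y hy hyV.1, hfg' y hy hyV.2]

/-- The space with functions glued from a family of parametrizations `ψ i : ℝ^(σ i) → X` by
affine spaces: a set is open, and a function is regular on it, if this is so in every chart. -/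
def glued {ι : Type*} {σ : ι → Type*} (ψ : ∀ i, (σ i → ℝ) → X) : SpaceWithFunctions X where
  top := ⨆ i, TopologicalSpace.coinduced (ψ i) (zariskiTopology (σ i))
  Regular U f := ∀ i, (affineSpace (σ i)).Regular (ψ i ⁻¹' U) (f ∘ ψ i)
  congr h hf i := (affineSpace (σ i)).congr (fun _ ha => h ha) (hf i)
  mono hU hV hVU hf i := (affineSpace (σ i)).mono
    (isOpen_coinduced.1 (isOpen_iSup_iff.1 hU i)) (isOpen_coinduced.1 (isOpen_iSup_iff.1 hV i))
    (Set.preimage_mono hVU) (hf i)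
  glue hU h i := (affineSpace (σ i)).glue (isOpen_coinduced.1 (isOpen_iSup_iff.1 hU i))
    fun a ha => by
      obtain ⟨V, hV, haV, hVU, hf⟩ := h (ψ i a) ha
      exact ⟨ψ i ⁻¹' V, isOpen_coinduced.1 (isOpen_iSup_iff.1 hV i), haV,
        Set.preimage_mono hVU, hf i⟩
  const c hU i := (affineSpace (σ i)).const c (isOpen_coinduced.1 (isOpen_iSup_iff.1 hU i))
  add hU hf hg i :=
    (affineSpace (σ i)).add (isOpen_coinduced.1 (isOpen_iSup_iff.1 hU i)) (hf i) (hg i)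
  mul hU hf hg i :=
    (affineSpace (σ i)).mul (isOpen_coinduced.1 (isOpen_iSup_iff.1 hU i)) (hf i) (hg i)

/-- Morphisms (regular maps): continuous maps that pull regular functions back to regular
functions. -/
def IsMorphism (S : SpaceWithFunctions X) (T : SpaceWithFunctions Y) (φ : X → Y) : Prop :=
  Continuous[S.top, T.top] φ ∧
    ∀ (U : Set Y) (f : Y → ℝ), IsOpen[T.top] U → T.Regular U f → S.Regular (φ ⁻¹' U) (f ∘ φ)

/-- Isomorphisms (biregular maps). -/
def IsIsomorphism (S : SpaceWithFunctions X) (T : SpaceWithFunctions Y) (e : X ≃ Y) : Prop :=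
  S.IsMorphism T e ∧ T.IsMorphism S e.symm

/-- `φ` is an isomorphism onto its image, the image having the structure induced from `Y`. -/
def IsVarietyEmbedding (S : SpaceWithFunctions X) (T : SpaceWithFunctions Y) (φ : X → Y) : Prop :=
  ∃ e : X ≃ Set.range φ, (∀ x, (e x : Y) = φ x) ∧ S.IsIsomorphism (T.induced (Set.range φ)) e

/-- Affine real algebraic varieties: isomorphic to a Zariski closed subset of some `ℝ^m` with its
regular functions. -/
def IsAffineVariety (S : SpaceWithFunctions X) : Prop :=
  ∃ (m : ℕ) (V : Set (Fin m → ℝ)), IsClosed[zariskiTopology (Fin m)] V ∧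
    ∃ e : X ≃ V, S.IsIsomorphism ((affineSpace (Fin m)).induced V) e

/-- Separatedness: two morphisms from an affine variety agree on a closed set. -/
def IsSeparatedSpace (S : SpaceWithFunctions X) : Prop :=
  ∀ (m : ℕ) (V : Set (Fin m → ℝ)), IsClosed[zariskiTopology (Fin m)] V →
    ∀ f g : V → X, ((affineSpace (Fin m)).induced V).IsMorphism S f →
      ((affineSpace (Fin m)).induced V).IsMorphism S g →
        IsClosed[((affineSpace (Fin m)).induced V).top] {v | f v = g v}

/-- (Abstract) real algebraic varieties: separated, and covered by finitely many open subsets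
that are affine varieties. -/
def IsAlgebraicVariety (S : SpaceWithFunctions X) : Prop :=
  (∃ (r : ℕ) (U : Fin r → Set X), (∀ i, IsOpen[S.top] (U i)) ∧ (⋃ i, U i) = Set.univ ∧
    ∀ i, (S.induced (U i)).IsAffineVariety) ∧ S.IsSeparatedSpace

/-- Irreducibility: the underlying topological space is irreducible (in particular non-empty). -/
def IsIrreducibleVariety (S : SpaceWithFunctions X) : Prop :=
  @IrreducibleSpace X S.top

/-- The local ring at `x`: germs at `x` of functions that are regular on an open neighbourhood
of `x`. -/
def localRing (S : SpaceWithFunctions X) (x : X) :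
    Subring (Filter.Germ (@nhds X S.top x) ℝ) where
  carrier := {γ | ∃ (U : Set X) (f : X → ℝ), IsOpen[S.top] U ∧ x ∈ U ∧ S.Regular U f ∧
    γ = (f : Filter.Germ (@nhds X S.top x) ℝ)}
  zero_mem' := ⟨Set.univ, fun _ => 0, @isOpen_univ _ S.top, Set.mem_univ _,
    S.const 0 (@isOpen_univ _ S.top), rfl⟩
  one_mem' := ⟨Set.univ, fun _ => 1, @isOpen_univ _ S.top, Set.mem_univ _,
    S.const 1 (@isOpen_univ _ S.top), rfl⟩
  add_mem' := by
    rintro _ _ ⟨U, f, hU, hxU, hf, rfl⟩ ⟨V, g, hV, hxV, hg, rfl⟩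
    have hUV : IsOpen[S.top] (U ∩ V) := @IsOpen.inter _ S.top U V hU hV
    exact ⟨U ∩ V, f + g, hUV, ⟨hxU, hxV⟩, S.add hUV (S.mono hU hUV Set.inter_subset_left hf)
      (S.mono hV hUV Set.inter_subset_right hg), rfl⟩
  mul_mem' := by
    rintro _ _ ⟨U, f, hU, hxU, hf, rfl⟩ ⟨V, g, hV, hxV, hg, rfl⟩
    have hUV : IsOpen[S.top] (U ∩ V) := @IsOpen.inter _ S.top U V hU hV
    exact ⟨U ∩ V, f * g, hUV, ⟨hxU, hxV⟩, S.mul hUV (S.mono hU hUV Set.inter_subset_left hf)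
      (S.mono hV hUV Set.inter_subset_right hg), rfl⟩
  neg_mem' := by
    rintro _ ⟨U, f, hU, hxU, hf, rfl⟩
    refine ⟨U, (fun _ => (-1 : ℝ)) * f, hU, hxU, S.mul hU (S.const (-1) hU) hf, ?_⟩
    have h : (fun _ => (-1 : ℝ)) * f = -f := by
      funext y
      simp
    rw [h]
    rfl

/-- Nonsingularity: every local ring is a regular local ring. -/
def IsNonsingular (S : SpaceWithFunctions X) : Prop :=
  ∀ x, IsRegularLocalRing (S.localRing x)

end SpaceWithFunctions

/-! ### The Grassmannian and the affine Grassmannian -/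

/-- The set `Gr(k, n)` of `k`-dimensional linear subspaces of `ℝ^n`. -/
def Gr (k n : ℕ) : Type :=
  {A : Submodule ℝ (Fin n → ℝ) // Module.finrank ℝ A = k}

/-- The set `Graff(k, n)` of `k`-dimensional (non-empty) affine subspaces of `ℝ^n`. -/
def Graff (k n : ℕ) : Type :=
  {S : AffineSubspace ℝ (Fin n → ℝ) //
    (S : Set (Fin n → ℝ)).Nonempty ∧ Module.finrank ℝ S.direction = k}

/-- The `k`-element sets of rows of an `n`-rowed matrix, indexing the standard charts. -/
abbrev RowSet (k n : ℕ) : Type := {I : Finset (Fin n) // I.card = k}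

/-- For the matrix `M` with rows indexed by the complement of `I` and columns indexed by `I`, this
is the linear map of the `n × k` matrix whose `I`-rows form the identity matrix and whose
other rows form `M`. -/
def normalizedFrame {n : ℕ} (I : Finset (Fin n)) (M : {i // i ∉ I} × {i // i ∈ I} → ℝ) :
    ({i // i ∈ I} → ℝ) →ₗ[ℝ] (Fin n → ℝ) :=
  LinearMap.pi fun i =>
    if h : i ∈ I then LinearMap.proj ⟨i, h⟩
    else ∑ j, M (⟨i, h⟩, j) • LinearMap.proj j

theorem normalizedFrame_injective {n : ℕ} (I : Finset (Fin n))
    (M : {i // i ∉ I} × {i // i ∈ I} → ℝ) : Function.Injective (normalizedFrame I M) := by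
  intro u v huv
  funext j
  have h := congrFun huv j.1
  simpa [normalizedFrame, j.2] using h

theorem finrank_range_normalizedFrame {k n : ℕ} (I : RowSet k n)
    (M : {i // i ∉ I.1} × {i // i ∈ I.1} → ℝ) :
    Module.finrank ℝ (LinearMap.range (normalizedFrame I.1 M)) = k := by
  rw [LinearMap.finrank_range_of_inj (normalizedFrame_injective I.1 M)]
  simp [I.2]

/-- The inverse of the standard chart of `Gr(k, n)` on the set where the `I`-minor does not
vanish. -/
def grChart {k n : ℕ} (I : RowSet k n) (M : {i // i ∉ I.1} × {i // i ∈ I.1} → ℝ) : Gr k n :=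
  ⟨LinearMap.range (normalizedFrame I.1 M), finrank_range_normalizedFrame I M⟩

/-- The normalized displacement vector: its `I`-entries vanish, its other entries are `y`. -/
def normalizedDisplacement {n : ℕ} (I : Finset (Fin n)) (y : {i // i ∉ I} → ℝ) : Fin n → ℝ :=
  fun i => if h : i ∈ I then 0 else y ⟨i, h⟩

/-- The inverse of the standard chart of `Graff(k, n)` on the set where the `I`-minor of
the direction does not vanish. The coordinates `c` are the rows outside `I` of the affine
coordinate matrix `[X, y]`, the last column `y` being indexed by `none`. -/
def graffChart {k n : ℕ} (I : RowSet k n) (c : {i // i ∉ I.1} × Option {i // i ∈ I.1} → ℝ) :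
    Graff k n :=
  ⟨AffineSubspace.mk' (normalizedDisplacement I.1 fun i => c (i, none))
      (LinearMap.range (normalizedFrame I.1 fun p => c (p.1, some p.2))),
    AffineSubspace.mk'_nonempty _ _, by
      rw [AffineSubspace.direction_mk']
      exact finrank_range_normalizedFrame I _⟩

/-- `Gr(k, n)` as a space with functions, glued from its standard charts. -/
def grVariety (k n : ℕ) : SpaceWithFunctions (Gr k n) :=
  SpaceWithFunctions.glued fun I : RowSet k n => grChart I

/-- `Graff(k, n)` as a space with functions, glued from its standard charts. -/
def graffVariety (k n : ℕ) : SpaceWithFunctions (Graff k n) :=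
  SpaceWithFunctions.glued fun I : RowSet k n => graffChart I

/-- The manifold topology of `Gr(k, n)`: the one glued from the Euclidean topologies of the
standard charts. -/
abbrev grManifoldTopology (k n : ℕ) : TopologicalSpace (Gr k n) :=
  ⨆ I : RowSet k n, TopologicalSpace.coinduced (grChart I) inferInstance

/-- The manifold topology of `Graff(k, n)`. -/
abbrev graffManifoldTopology (k n : ℕ) : TopologicalSpace (Graff k n) :=
  ⨆ I : RowSet k n, TopologicalSpace.coinduced (graffChart I) inferInstance

/-- The inclusion `ℝ^n → ℝ^(n+1)`, `x ↦ (x, 0)`. -/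
def inclLast (n : ℕ) : (Fin n → ℝ) →ₗ[ℝ] (Fin (n + 1) → ℝ) where
  toFun x := Fin.snoc x 0
  map_add' x y := by
    funext i
    refine Fin.lastCases ?_ (fun i => ?_) i <;> simp
  map_smul' c x := by
    funext i
    refine Fin.lastCases ?_ (fun i => ?_) i <;> simp

/-!
# The affine Grassmannian as an open subvariety of a Grassmannian

The matrix of a `k`-dimensional subspace whose `I`-rows form the identity describes the subspace by
linear equations (`mem_grChart`), and the subspace lies in the `I`-th chart if and only if its
projection to the coordinates in `I` is injective (`mem_range_grChart_iff`). Hence the charts cover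
`Gr(k, n)`, and by Cramer's rule the transitions between them are quotients of polynomials whose
denominator vanishes exactly outside the common domain (`exists_transition`). So each chart is an
isomorphism of an affine space onto an open subset (`SpaceWithFunctions.IsAtlas`,
`isAtlas_grChart`). This makes the local rings localizations of polynomial rings at maximal ideals,
which are regular (`IsAtlas.isNonsingular`). Separatedness holds because the equality of points of
two charts is a system of polynomial equations in both sets of coordinates
(`isSeparatedSpace_grVariety`). Irreducibility holds because some subspace lies in all charts: the
values of polynomials of degree less than `k` at `n` points (`exists_forall_mem_range_grChart`).

The two maps of the theorem are treated by one criterion, `SpaceWithFunctions.IsChartwiseEmbedding`: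
an injective map that embeds each chart of the source in a chart of the target by a coordinate map
with a polynomial retraction is an isomorphism onto its image, and an atlas of the target yields
one of the source.

* The cone over `S` in `Graff(k, n)` with affine coordinate matrix `[X, y]` is the range of
  `[X, y; 0, 1]`, which is normalized for the rows of `I` and the last row. So the homogenization is
  a relabelling of coordinates in the charts (`homogenization_graffChart`), and its image is the
  union of the charts whose rows contain the last one. All properties of `Graff(k, n)` follow from
  those of `Gr(k + 1, n + 1)`. The image is a nonempty open subset of an irreducible space, hence
  dense; in each chart it contains the nonvanishing locus of a nonzero polynomial, so it is also
  dense in the Euclidean topology (`IsAtlas.dense_euclidean`).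
* A subspace outside the union of these charts lies in `E_n`: otherwise a row of one of its charts
  can be exchanged for the last row (`compl_range_homogenization`). The Grassmannian of `E_n` is
  cut out in the other charts by the vanishing of the last row of the matrix
  (`isChartwiseEmbedding_inclLast`).
-/

/-! ### The Zariski topology and regular functions of an affine space -/

section AffineSpace

variable {σ : Type*}

theorem isOpen_eval_ne_zero (p : MvPolynomial σ ℝ) :
    IsOpen[zariskiTopology σ] {z | MvPolynomial.eval z p ≠ 0} := by
  let := zariskiTopology σ
  rw [← isClosed_compl_iff]
  have h : IsClosed[zariskiTopology σ] (MvPolynomial.zeroLocus ℝ (Ideal.span {p})) := by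
    constructor
    exact ⟨Ideal.span {p}, by simp⟩
  convert h using 1
  ext z
  simp [MvPolynomial.zeroLocus_span, MvPolynomial.aeval_eq_eval]

theorem exists_eval_ne_zero_of_isOpen {U : Set (σ → ℝ)} (hU : IsOpen[zariskiTopology σ] U)
    {a : σ → ℝ} (ha : a ∈ U) :
    ∃ p : MvPolynomial σ ℝ, MvPolynomial.eval a p ≠ 0 ∧
      ∀ z, MvPolynomial.eval z p ≠ 0 → z ∈ U := by
  obtain ⟨I, hI⟩ : Uᶜ ∈ Set.range
    fun I : Ideal (MvPolynomial σ ℝ) => MvPolynomial.zeroLocus ℝ I := hU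
  have h : a ∉ MvPolynomial.zeroLocus ℝ I := fun h => by
    have h' : a ∈ Uᶜ := by rw [← hI]; exact h
    exact h' ha
  simp only [MvPolynomial.mem_zeroLocus_iff, not_forall] at h
  obtain ⟨p, hp, hpa⟩ := h
  refine ⟨p, by simpa [MvPolynomial.aeval_eq_eval] using hpa, fun z hz => ?_⟩
  by_contra hzU
  have h' : z ∈ MvPolynomial.zeroLocus ℝ I := by
    have h' : z ∈ Uᶜ := hzU
    rw [← hI] at h'
    exact h'
  exact hz (by simpa [MvPolynomial.aeval_eq_eval] using h' p hp)

/-- Two nonempty Zariski open subsets of `ℝ^σ` meet. -/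
theorem nonempty_inter_of_isOpen_zariski {U V : Set (σ → ℝ)} (hU : IsOpen[zariskiTopology σ] U)
    (hV : IsOpen[zariskiTopology σ] V) (hU' : U.Nonempty) (hV' : V.Nonempty) :
    (U ∩ V).Nonempty := by
  obtain ⟨a, ha⟩ := hU'
  obtain ⟨b, hb⟩ := hV'
  obtain ⟨p, hpa, hp⟩ := exists_eval_ne_zero_of_isOpen hU ha
  obtain ⟨q, hqb, hq⟩ := exists_eval_ne_zero_of_isOpen hV hb
  have hpq : p * q ≠ 0 := by
    refine mul_ne_zero ?_ ?_
    · rintro rfl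
      simp at hpa
    · rintro rfl
      simp at hqb
  by_contra h
  refine hpq (MvPolynomial.funext fun z => ?_)
  rw [map_mul, map_zero]
  by_contra hz
  exact h ⟨z, hp z (left_ne_zero_of_mul hz), hq z (right_ne_zero_of_mul hz)⟩

/-- Polynomials that agree on a nonempty Zariski open set are equal. -/
theorem eq_of_eqOn_isOpen_zariski {U : Set (σ → ℝ)} (hU : IsOpen[zariskiTopology σ] U)
    (hU' : U.Nonempty) {p q : MvPolynomial σ ℝ}
    (h : ∀ z ∈ U, MvPolynomial.eval z p = MvPolynomial.eval z q) : p = q := by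
  by_contra hpq
  obtain ⟨b, hb⟩ : ∃ b, MvPolynomial.eval b (p - q) ≠ 0 := by
    by_contra hcon
    push Not at hcon
    exact hpq (sub_eq_zero.1 (MvPolynomial.funext fun z => by rw [hcon z, map_zero]))
  obtain ⟨z, hzU, hz⟩ :=
    nonempty_inter_of_isOpen_zariski hU (isOpen_eval_ne_zero (p - q)) hU' ⟨b, hb⟩
  exact hz (by rw [map_sub, h z hzU, sub_self])

theorem affineSpace_regular_eval {U : Set (σ → ℝ)} (hU : IsOpen[zariskiTopology σ] U)
    (p : MvPolynomial σ ℝ) : (affineSpace σ).Regular U fun z => MvPolynomial.eval z p :=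
  fun _ ha => ⟨U, hU, ha, subset_rfl, p, 1, by simp⟩

/-- The Euclidean topology is finer than the Zariski topology. -/
theorem IsOpen.of_zariski {U : Set (σ → ℝ)} (hU : IsOpen[zariskiTopology σ] U) : IsOpen U := by
  rw [isOpen_iff_forall_mem_open]
  intro a ha
  obtain ⟨p, hpa, hp⟩ := exists_eval_ne_zero_of_isOpen hU ha
  exact ⟨_, hp, isOpen_ne_fun (MvPolynomial.continuous_eval p) continuous_const, hpa⟩

/-- Regular functions are continuous for the Euclidean topology. -/
theorem continuousOn_of_regular {U : Set (σ → ℝ)} {f : (σ → ℝ) → ℝ}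
    (hf : (affineSpace σ).Regular U f) : ContinuousOn f U := by
  intro a ha
  obtain ⟨V, hV, haV, -, p, q, hpq⟩ := hf a ha
  have h : ContinuousAt (fun z => MvPolynomial.eval z p / MvPolynomial.eval z q) a :=
    (MvPolynomial.continuous_eval p).continuousAt.div
      (MvPolynomial.continuous_eval q).continuousAt (hpq a haV).1
  refine (h.congr ?_).continuousWithinAt
  filter_upwards [hV.of_zariski.mem_nhds haV] with z hz
  exact (hpq z hz).2.symm

/-- A nonempty Zariski open subset of `ℝ^σ` is dense for the Euclidean topology: a polynomial that
is nonzero at `b` has finitely many zeros on the line from `a` to `b`. -/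
theorem dense_of_isOpen_zariski [Finite σ] {U : Set (σ → ℝ)} (hU : IsOpen[zariskiTopology σ] U)
    (hU' : U.Nonempty) : Dense U := by
  obtain ⟨b, hb⟩ := hU'
  obtain ⟨p, hpb, hp⟩ := exists_eval_ne_zero_of_isOpen hU hb
  have := Fintype.ofFinite σ
  intro a
  by_contra ha
  have hev : (fun z => MvPolynomial.eval z p) =ᶠ[𝓝 a] fun _ => 0 := by
    filter_upwards [isClosed_closure.isOpen_compl.mem_nhds ha] with z hz
    by_contra hz0
    exact hz (subset_closure (hp z hz0))
  have han : AnalyticOnNhd ℝ (fun z => MvPolynomial.eval z p) (Set.univ : Set (σ → ℝ)) :=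
    AnalyticOnNhd.eval_mvPolynomial p
  exact hpb (congrFun (han.eq_of_eventuallyEq analyticOnNhd_const hev) b)

end AffineSpace

namespace SpaceWithFunctions

variable {X Y Z : Type*}

/-! ### Spaces with invertible nonvanishing functions -/

/-- The zero locus of a regular function is closed, and a regular function is invertible where it
does not vanish. -/
def IsLocal (S : SpaceWithFunctions X) : Prop :=
  ∀ (U : Set X) (f : X → ℝ), IsOpen[S.top] U → S.Regular U f →
    IsOpen[S.top] {x ∈ U | f x ≠ 0} ∧ S.Regular {x ∈ U | f x ≠ 0} fun x => (f x)⁻¹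

theorem isLocal_affineSpace (σ : Type*) : (affineSpace σ).IsLocal := by
  intro U f _ hf
  have key : ∀ a ∈ {x ∈ U | f x ≠ 0}, ∃ V : Set (σ → ℝ), IsOpen[zariskiTopology σ] V ∧ a ∈ V ∧
      V ⊆ {x ∈ U | f x ≠ 0} ∧ ∃ p q : MvPolynomial σ ℝ, ∀ z ∈ V,
        MvPolynomial.eval z q ≠ 0 ∧ (f z)⁻¹ = MvPolynomial.eval z p / MvPolynomial.eval z q := by
    rintro a ⟨ha, ha0⟩
    obtain ⟨V, hV, haV, hVU, p, q, hpq⟩ := hf a ha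
    refine ⟨V ∩ {z | MvPolynomial.eval z p ≠ 0},
      @IsOpen.inter _ (zariskiTopology σ) _ _ hV (isOpen_eval_ne_zero p), ⟨haV, fun h => ha0 ?_⟩,
      fun z hz => ⟨hVU hz.1, ?_⟩, q, p, fun z hz => ⟨hz.2, ?_⟩⟩
    · rw [(hpq a haV).2, h, zero_div]
    · rw [(hpq z hz.1).2]
      exact div_ne_zero hz.2 (hpq z hz.1).1
    · rw [(hpq z hz.1).2, inv_div]
  refine ⟨?_, key⟩
  let := zariskiTopology σ
  refine isOpen_iff_forall_mem_open.2 fun a ha => ?_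
  obtain ⟨V, hV, haV, hVU, -⟩ := key a ha
  exact ⟨V, hVU, hV, haV⟩

theorem IsLocal.induced {T : SpaceWithFunctions X} (hT : T.IsLocal) (S : Set X) :
    (T.induced S).IsLocal := by
  intro U f hU hf
  have key : ∀ x ∈ {x ∈ U | f x ≠ 0}, ∃ V : Set X, IsOpen[T.top] V ∧ (x : X) ∈ V ∧
      (∀ y ∈ U, (y : X) ∈ V → f y ≠ 0) ∧
      ∃ g : X → ℝ, T.Regular V g ∧ ∀ y ∈ U, (y : X) ∈ V → (f y)⁻¹ = g y := by
    rintro x ⟨hx, hx0⟩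
    obtain ⟨V, hV, hxV, g, hg, hfg⟩ := hf x hx
    obtain ⟨h1, h2⟩ := hT V g hV hg
    refine ⟨_, h1, ⟨hxV, hfg x hx hxV ▸ hx0⟩, fun y hy hyV => hfg y hy hyV.1 ▸ hyV.2, _, h2,
      fun y hy hyV => by rw [hfg y hy hyV.1]⟩
  constructor
  · let := (T.induced S).top
    refine isOpen_iff_forall_mem_open.2 fun x hx => ?_
    obtain ⟨V, hV, hxV, hfV, -⟩ := key x hx
    exact ⟨U ∩ Subtype.val ⁻¹' V, fun y hy => ⟨hy.1, hfV y hy.1 hy.2⟩,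
      hU.inter ⟨V, hV, rfl⟩, hx.1, hxV⟩
  · intro x hx
    obtain ⟨V, hV, hxV, -, g, hg, hfg⟩ := key x hx
    exact ⟨V, hV, hxV, g, hg, fun y hy hyV => hfg y hy.1 hyV⟩

theorem isOpen_glued_iff {ι : Type*} {σ : ι → Type*} {ψ : ∀ i, (σ i → ℝ) → X} {U : Set X} :
    IsOpen[(glued ψ).top] U ↔ ∀ i, IsOpen[zariskiTopology (σ i)] (ψ i ⁻¹' U) :=
  isOpen_iSup_iff.trans (forall_congr' fun _ => isOpen_coinduced)

theorem isLocal_glued {ι : Type*} {σ : ι → Type*} (ψ : ∀ i, (σ i → ℝ) → X) :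
    (glued ψ).IsLocal := by
  intro U f hU hf
  have h i := isLocal_affineSpace (σ i) _ _ (isOpen_glued_iff.1 hU i) (hf i)
  exact ⟨isOpen_glued_iff.2 fun i => (h i).1, fun i => (h i).2⟩

/-! ### Morphisms defined on an open set -/

/-- `φ` restricts to a morphism on the open set `U`. -/
def IsMorphismOn (S : SpaceWithFunctions X) (T : SpaceWithFunctions Y) (U : Set X) (φ : X → Y) :
    Prop :=
  ∀ V : Set Y, IsOpen[T.top] V → IsOpen[S.top] (U ∩ φ ⁻¹' V) ∧
    ∀ f : Y → ℝ, T.Regular V f → S.Regular (U ∩ φ ⁻¹' V) (f ∘ φ)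

theorem isMorphismOn_univ {S : SpaceWithFunctions X} {T : SpaceWithFunctions Y} {φ : X → Y} :
    S.IsMorphismOn T Set.univ φ ↔ S.IsMorphism T φ := by
  constructor
  · intro h
    refine ⟨?_, fun V f hV hf => by simpa using (h V hV).2 f hf⟩
    let := S.top
    let := T.top
    exact continuous_def.2 fun V hV => by simpa using (h V hV).1
  · intro h V hV
    refine ⟨?_, fun f hf => by simpa using h.2 V f hV hf⟩
    let := S.top
    let := T.top
    simpa using hV.preimage h.1

theorem IsMorphism.isOpen_preimage {S : SpaceWithFunctions X} {T : SpaceWithFunctions Y}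
    {φ : X → Y} (h : S.IsMorphism T φ) {V : Set Y} (hV : IsOpen[T.top] V) :
    IsOpen[S.top] (φ ⁻¹' V) := by
  simpa using (isMorphismOn_univ.2 h V hV).1

theorem IsMorphismOn.comp {S : SpaceWithFunctions X} {T : SpaceWithFunctions Y}
    {R : SpaceWithFunctions Z} {U : Set X} {W : Set Y} {φ : X → Y} {χ : Y → Z}
    (hχ : T.IsMorphismOn R W χ) (hφ : S.IsMorphismOn T U φ) :
    S.IsMorphismOn R (U ∩ φ ⁻¹' W) (χ ∘ φ) := by
  intro V hV
  have h := hφ _ (hχ V hV).1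
  rw [Set.preimage_inter, ← Set.inter_assoc] at h
  exact ⟨h.1, fun f hf => h.2 _ ((hχ V hV).2 f hf)⟩

theorem IsMorphism.comp {S : SpaceWithFunctions X} {T : SpaceWithFunctions Y}
    {R : SpaceWithFunctions Z} {φ : X → Y} {χ : Y → Z}
    (hχ : T.IsMorphism R χ) (hφ : S.IsMorphism T φ) : S.IsMorphism R (χ ∘ φ) := by
  have h := (isMorphismOn_univ.2 hχ).comp (isMorphismOn_univ.2 hφ)
  rw [Set.preimage_univ, Set.inter_univ] at h
  exact isMorphismOn_univ.1 h

theorem IsMorphismOn.comp_isMorphism {S : SpaceWithFunctions X} {T : SpaceWithFunctions Y}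
    {R : SpaceWithFunctions Z} {W : Set Y} {φ : X → Y} {χ : Y → Z}
    (hχ : T.IsMorphismOn R W χ) (hφ : S.IsMorphism T φ) :
    S.IsMorphismOn R (φ ⁻¹' W) (χ ∘ φ) := by
  simpa using hχ.comp (isMorphismOn_univ.2 hφ)

theorem IsMorphism.comp_isMorphismOn {S : SpaceWithFunctions X} {T : SpaceWithFunctions Y}
    {R : SpaceWithFunctions Z} {U : Set X} {φ : X → Y} {χ : Y → Z}
    (hχ : T.IsMorphism R χ) (hφ : S.IsMorphismOn T U φ) :
    S.IsMorphismOn R U (χ ∘ φ) := by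
  simpa using (isMorphismOn_univ.2 hχ).comp hφ

theorem IsMorphismOn.congr {S : SpaceWithFunctions X} {T : SpaceWithFunctions Y}
    {U : Set X} {φ χ : X → Y} (hφ : S.IsMorphismOn T U φ) (h : Set.EqOn φ χ U) :
    S.IsMorphismOn T U χ := by
  intro V hV
  rw [← h.inter_preimage_eq]
  exact ⟨(hφ V hV).1, fun f hf =>
    S.congr (fun x hx => congrArg f (h hx.1)) ((hφ V hV).2 f hf)⟩

/-- Being a morphism is local on the source. -/
theorem isMorphism_of_cover {S : SpaceWithFunctions X} {T : SpaceWithFunctions Y} {φ : X → Y}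
    (h : ∀ x, ∃ U, x ∈ U ∧ S.IsMorphismOn T U φ) : S.IsMorphism T φ := by
  have key : ∀ V, IsOpen[T.top] V → ∀ x ∈ φ ⁻¹' V, ∃ U, IsOpen[S.top] U ∧ x ∈ U ∧ U ⊆ φ ⁻¹' V ∧
      ∀ f, T.Regular V f → S.Regular U (f ∘ φ) := by
    intro V hV x hx
    obtain ⟨U, hxU, hU⟩ := h x
    exact ⟨_, (hU V hV).1, ⟨hxU, hx⟩, Set.inter_subset_right, (hU V hV).2⟩
  have hopen : ∀ V, IsOpen[T.top] V → IsOpen[S.top] (φ ⁻¹' V) := by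
    intro V hV
    let := S.top
    refine isOpen_iff_forall_mem_open.2 fun x hx => ?_
    obtain ⟨U, hU, hxU, hUV, -⟩ := key V hV x hx
    exact ⟨U, hUV, hU, hxU⟩
  refine ⟨?_, fun V f hV hf => S.glue (hopen V hV) fun x hx => ?_⟩
  · let := S.top
    let := T.top
    exact continuous_def.2 hopen
  · obtain ⟨U, hU, hxU, hUV, hreg⟩ := key V hV x hx
    exact ⟨U, hU, hxU, hUV, hreg f hf⟩

theorem isMorphism_glued_iff {ι : Type*} {σ : ι → Type*} {ψ : ∀ i, (σ i → ℝ) → X}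
    {T : SpaceWithFunctions Y} {φ : X → Y} :
    (glued ψ).IsMorphism T φ ↔ ∀ i, (affineSpace (σ i)).IsMorphism T (φ ∘ ψ i) := by
  constructor
  · intro h i
    refine ⟨?_, fun V f hV hf => h.2 V f hV hf i⟩
    let := zariskiTopology (σ i)
    let := T.top
    exact continuous_def.2 fun V hV => isOpen_glued_iff.1 (h.isOpen_preimage hV) i
  · intro h
    refine ⟨?_, fun V f hV hf i => (h i).2 V f hV hf⟩
    let := (glued ψ).top
    let := T.top
    exact continuous_def.2 fun V hV => isOpen_glued_iff.2 fun i => (h i).isOpen_preimage hV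

theorem isMorphism_id (S : SpaceWithFunctions X) : S.IsMorphism S id :=
  ⟨@continuous_id _ S.top, fun _ _ _ h => h⟩

theorem isMorphism_chart {ι : Type*} {σ : ι → Type*} (ψ : ∀ i, (σ i → ℝ) → X) (i : ι) :
    (affineSpace (σ i)).IsMorphism (glued ψ) (ψ i) :=
  isMorphism_glued_iff.1 (isMorphism_id (glued ψ)) i

theorem isMorphism_val (T : SpaceWithFunctions Y) (S : Set Y) :
    (T.induced S).IsMorphism T Subtype.val :=
  ⟨@continuous_induced_dom _ _ _ T.top, fun V f hV hf _ hx => ⟨V, hV, hx, f, hf, fun _ _ _ => rfl⟩⟩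

/-- A morphism with values in `S` is a morphism to `S` with its induced structure. -/
theorem IsMorphism.codRestrict {T : SpaceWithFunctions X} {R : SpaceWithFunctions Y} {S : Set Y}
    {φ : X → S} (hφ : T.IsMorphism R fun x => (φ x : Y)) : T.IsMorphism (R.induced S) φ := by
  have hcont : Continuous[T.top, (R.induced S).top] φ := by
    let := T.top
    let := R.top
    exact continuous_induced_rng.2 hφ.1
  have hopen : ∀ V, IsOpen[(R.induced S).top] V → IsOpen[T.top] (φ ⁻¹' V) := by
    let := T.top
    let := (R.induced S).top
    exact fun V hV => hV.preimage hcont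
  refine ⟨hcont, fun V f hV hf => T.glue (hopen V hV) fun x hx => ?_⟩
  obtain ⟨W, hW, hxW, g, hg, hfg⟩ := hf (φ x) hx
  have hW' := hφ.isOpen_preimage hW
  have hI : IsOpen[T.top] (φ ⁻¹' V ∩ (fun x => (φ x : Y)) ⁻¹' W) :=
    @IsOpen.inter _ T.top _ _ (hopen V hV) hW'
  refine ⟨_, hI, ⟨hx, hxW⟩, Set.inter_subset_left, ?_⟩
  exact T.congr (fun y hy => (hfg (φ y) hy.1 hy.2).symm)
    (T.mono hW' hI Set.inter_subset_right (hφ.2 W g hW hg))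

/-! ### Maps to affine space -/

theorem regular_eval_comp {S : SpaceWithFunctions X} {σ : Type*} {U : Set X} (hU : IsOpen[S.top] U)
    {τ : X → σ → ℝ} (hτ : ∀ s, S.Regular U fun x => τ x s) (p : MvPolynomial σ ℝ) :
    S.Regular U fun x => MvPolynomial.eval (τ x) p := by
  induction p using MvPolynomial.induction_on with
  | C a => simpa using S.const a hU
  | add p q hp hq => simpa [Pi.add_def] using S.add hU hp hq
  | mul_X p s hp => simpa [Pi.mul_def] using S.mul hU hp (hτ s)

/-- A map to an affine space is a morphism as soon as its coordinates are regular. -/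
theorem IsLocal.isMorphismOn_affineSpace {S : SpaceWithFunctions X} (hS : S.IsLocal) {σ : Type*}
    {U : Set X} (hU : IsOpen[S.top] U) {τ : X → σ → ℝ} (hτ : ∀ s, S.Regular U fun x => τ x s) :
    S.IsMorphismOn (affineSpace σ) U τ := by
  intro V hV
  have hopen : ∀ V, IsOpen[zariskiTopology σ] V → IsOpen[S.top] (U ∩ τ ⁻¹' V) := by
    intro V hV
    let := S.top
    refine isOpen_iff_forall_mem_open.2 fun x hx => ?_
    obtain ⟨p, hp0, hp⟩ := exists_eval_ne_zero_of_isOpen hV hx.2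
    exact ⟨_, fun y hy => ⟨hy.1, hp _ hy.2⟩, (hS _ _ hU (regular_eval_comp hU hτ p)).1, hx.1, hp0⟩
  refine ⟨hopen V hV, fun f hf => S.glue (hopen V hV) fun x hx => ?_⟩
  obtain ⟨W, hW, hxW, hWV, p, q, hpq⟩ := hf (τ x) hx.2
  have hUW := hopen W hW
  obtain ⟨hq, hqinv⟩ := hS _ _ hU (regular_eval_comp hU hτ q)
  have hsub : U ∩ τ ⁻¹' W ⊆ {x ∈ U | MvPolynomial.eval (τ x) q ≠ 0} :=
    fun y hy => ⟨hy.1, (hpq _ hy.2).1⟩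
  refine ⟨_, hUW, ⟨hx.1, hxW⟩, fun y hy => ⟨hy.1, hWV hy.2⟩, S.congr (fun y hy => ?_)
    (S.mul hUW (S.mono hU hUW Set.inter_subset_left (regular_eval_comp hU hτ p))
      (S.mono hq hUW hsub hqinv))⟩
  simp [(hpq _ hy.2).2, div_eq_mul_inv]

theorem IsMorphismOn.regular_coord {S : SpaceWithFunctions X} {σ : Type*} {U : Set X}
    {τ : X → σ → ℝ} (h : S.IsMorphismOn (affineSpace σ) U τ) (s : σ) :
    S.Regular U fun x => τ x s := by
  have huniv : IsOpen[zariskiTopology σ] Set.univ := @isOpen_univ _ (zariskiTopology σ)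
  simpa [Function.comp_def] using
    (h Set.univ huniv).2 _ (affineSpace_regular_eval huniv (MvPolynomial.X s))

theorem IsMorphismOn.isOpen {S : SpaceWithFunctions X} {T : SpaceWithFunctions Y} {U : Set X}
    {φ : X → Y} (h : S.IsMorphismOn T U φ) : IsOpen[S.top] U := by
  simpa using (h Set.univ (@isOpen_univ _ T.top)).1

/-- Maps between affine spaces with polynomial coordinates are morphisms. -/
theorem isMorphism_of_eval {σ τ : Type*} {a : (σ → ℝ) → τ → ℝ}
    (h : ∀ t, ∃ p : MvPolynomial σ ℝ, ∀ z, a z t = MvPolynomial.eval z p) :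
    (affineSpace σ).IsMorphism (affineSpace τ) a := by
  have huniv : IsOpen[zariskiTopology σ] Set.univ := @isOpen_univ _ (zariskiTopology σ)
  refine isMorphismOn_univ.1 ((isLocal_affineSpace σ).isMorphismOn_affineSpace huniv fun t => ?_)
  obtain ⟨p, hp⟩ := h t
  simpa [hp] using affineSpace_regular_eval huniv p

theorem IsMorphism.continuous_euclidean {σ τ : Type*} {a : (σ → ℝ) → τ → ℝ}
    (h : (affineSpace σ).IsMorphism (affineSpace τ) a) : Continuous a :=
  continuous_pi fun t => continuousOn_univ.1
    (continuousOn_of_regular ((isMorphismOn_univ.2 h).regular_coord t))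

end SpaceWithFunctions

namespace SpaceWithFunctions

variable {X Y : Type*} {ι κ : Type*} {σ : ι → Type*} {τ : κ → Type*}

/-! ### Atlases of affine spaces -/

/-- The parametrizations `ψ i` cover `X`, and each of them is an isomorphism of `ℝ^(σ i)` onto an
open subset of the glued space: it has an inverse `ρ` that is a morphism on its range. -/
structure IsAtlas (ψ : ∀ i, (σ i → ℝ) → X) : Prop where
  cover : ∀ x, ∃ i, x ∈ Set.range (ψ i)
  exists_inverse : ∀ i, ∃ ρ : X → σ i → ℝ, (∀ z, ρ (ψ i z) = z) ∧
    (glued ψ).IsMorphismOn (affineSpace (σ i)) (Set.range (ψ i)) ρ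

namespace IsAtlas

variable {ψ : ∀ i, (σ i → ℝ) → X}

theorem injective (h : IsAtlas ψ) (i : ι) : Function.Injective (ψ i) := by
  obtain ⟨ρ, hρ, -⟩ := h.exists_inverse i
  exact Function.LeftInverse.injective hρ

theorem isOpen_range (h : IsAtlas ψ) (i : ι) : IsOpen[(glued ψ).top] (Set.range (ψ i)) := by
  obtain ⟨ρ, -, hρ⟩ := h.exists_inverse i
  exact hρ.isOpen

theorem isAffineVariety_range (h : IsAtlas ψ) (i : ι) [Finite (σ i)] :
    ((glued ψ).induced (Set.range (ψ i))).IsAffineVariety := by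
  obtain ⟨ρ, hρ, hmor⟩ := h.exists_inverse i
  obtain ⟨m, ⟨e⟩⟩ := Finite.exists_equiv_fin (σ i)
  have hreindex : (affineSpace (σ i)).IsMorphism (affineSpace (Fin m)) fun z s => z (e.symm s) :=
    isMorphism_of_eval fun s => ⟨MvPolynomial.X (e.symm s), fun z => by simp⟩
  have hreindex' : (affineSpace (Fin m)).IsMorphism (affineSpace (σ i)) fun z s => z (e s) :=
    isMorphism_of_eval fun s => ⟨MvPolynomial.X (e s), fun z => by simp⟩
  refine ⟨m, Set.univ, @isClosed_univ _ (zariskiTopology _),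
    { toFun := fun x => ⟨fun s => ρ x (e.symm s), Set.mem_univ _⟩
      invFun := fun z => ⟨ψ i fun s => z.1 (e s), Set.mem_range_self _⟩
      left_inv := ?_
      right_inv := ?_ }, ?_, ?_⟩
  · rintro ⟨_, z, rfl⟩
    simp [hρ]
  · rintro ⟨z, -⟩
    simp [hρ]
  · have h1 := (hreindex.comp_isMorphismOn hmor).comp_isMorphism
      (isMorphism_val (glued ψ) (Set.range (ψ i)))
    rw [Subtype.coe_preimage_self] at h1
    exact (isMorphismOn_univ.1 h1).codRestrict
  · exact (((isMorphism_chart ψ i).comp hreindex').comp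
      (isMorphism_val (affineSpace (Fin m)) Set.univ)).codRestrict

/-- The charts form a finite cover by affine varieties. -/
theorem isAlgebraicVariety (h : IsAtlas ψ) [Finite ι] [∀ i, Finite (σ i)]
    (hsep : (glued ψ).IsSeparatedSpace) : (glued ψ).IsAlgebraicVariety := by
  obtain ⟨r, ⟨e⟩⟩ := Finite.exists_equiv_fin ι
  refine ⟨⟨r, fun s => Set.range (ψ (e.symm s)), fun s => h.isOpen_range _, ?_,
    fun s => h.isAffineVariety_range _⟩, hsep⟩
  refine Set.eq_univ_of_forall fun x => ?_
  obtain ⟨i, hi⟩ := h.cover x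
  exact Set.mem_iUnion.2 ⟨e i, (e.symm_apply_apply i).symm ▸ hi⟩

/-- A space covered by charts that have a point in common is irreducible. -/
theorem isIrreducibleVariety (h : IsAtlas ψ) {x : X} (hx : ∀ i, x ∈ Set.range (ψ i)) :
    (glued ψ).IsIrreducibleVariety := by
  let := (glued ψ).top
  refine { toNonempty := ⟨x⟩, isPreirreducible_univ := ?_ }
  rintro u v hu hv ⟨y, -, hy⟩ ⟨y', -, hy'⟩
  obtain ⟨i, z, rfl⟩ := h.cover y
  obtain ⟨j, w, rfl⟩ := h.cover y'
  obtain ⟨a, ha⟩ := hx i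
  obtain ⟨c, hcu, b, hb⟩ := nonempty_inter_of_isOpen_zariski (isOpen_glued_iff.1 hu i)
    (isOpen_glued_iff.1 (h.isOpen_range j) i) ⟨z, hy⟩ ⟨a, by rw [Set.mem_preimage, ha]; exact hx j⟩
  obtain ⟨d, hdu, hdv⟩ := nonempty_inter_of_isOpen_zariski (isOpen_glued_iff.1 hu j)
    (isOpen_glued_iff.1 hv j) ⟨b, by rw [Set.mem_preimage, hb]; exact hcu⟩ ⟨w, hy'⟩
  exact ⟨ψ j d, Set.mem_univ _, hdu, hdv⟩

/-- The local ring at a point of a chart `ℝ^σ` is the localization of the polynomial ring at the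
maximal ideal of the point, hence regular. -/
theorem isNonsingular (h : IsAtlas ψ) [∀ i, Finite (σ i)] : (glued ψ).IsNonsingular := by
  intro x
  obtain ⟨i, a, rfl⟩ := h.cover x
  obtain ⟨ρ, hρ, hmor⟩ := h.exists_inverse i
  let := (glued ψ).top
  have hopen := h.isOpen_range i
  have hmem : Set.range (ψ i) ∈ 𝓝 (ψ i a) := hopen.mem_nhds (Set.mem_range_self a)
  let F : MvPolynomial (σ i) ℝ →+* Filter.Germ (𝓝 (ψ i a)) ℝ :=
    (Filter.Germ.coeRingHom (R := ℝ) (𝓝 (ψ i a))).comp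
      (RingHom.pi fun y => MvPolynomial.eval (ρ y))
  have hF : ∀ p, F p = ((fun y => MvPolynomial.eval (ρ y) p : X → ℝ) :
      Filter.Germ (𝓝 (ψ i a)) ℝ) := fun _ => rfl
  have hreg : ∀ p, (glued ψ).Regular (Set.range (ψ i)) fun y => MvPolynomial.eval (ρ y) p :=
    regular_eval_comp hopen hmor.regular_coord
  let G : MvPolynomial (σ i) ℝ →+* (glued ψ).localRing (ψ i a) :=
    F.codRestrict _ fun p => ⟨_, _, hopen, Set.mem_range_self a, hreg p, rfl⟩
  let : Algebra (MvPolynomial (σ i) ℝ) ((glued ψ).localRing (ψ i a)) := G.toAlgebra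
  have hG : ∀ p, ((algebraMap (MvPolynomial (σ i) ℝ) ((glued ψ).localRing (ψ i a)) p :
      (glued ψ).localRing (ψ i a)) : Filter.Germ (𝓝 (ψ i a)) ℝ) =
        ((fun y => MvPolynomial.eval (ρ y) p : X → ℝ) : Filter.Germ (𝓝 (ψ i a)) ℝ) := fun _ => rfl
  let m : Ideal (MvPolynomial (σ i) ℝ) := RingHom.ker (MvPolynomial.eval a)
  have hm : m.IsPrime := RingHom.ker_isPrime _
  have hmem_m : ∀ {p}, p ∈ m.primeCompl ↔ MvPolynomial.eval a p ≠ 0 := Iff.rfl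
  have hloc : IsLocalization.AtPrime ((glued ψ).localRing (ψ i a)) m := by
    refine ⟨⟨?_, ?_, ?_⟩⟩
    · rintro ⟨p, hp⟩
      rw [hmem_m] at hp
      obtain ⟨h1, h2⟩ := isLocal_glued ψ _ _ hopen (hreg p)
      have hx : ψ i a ∈ {y ∈ Set.range (ψ i) | MvPolynomial.eval (ρ y) p ≠ 0} :=
        ⟨Set.mem_range_self a, by rwa [hρ]⟩
      refine IsUnit.of_mul_eq_one ⟨_, _, _, h1, hx, h2, rfl⟩ (Subtype.ext ?_)
      rw [Subring.coe_mul, hG, ← Filter.Germ.coe_mul, Subring.coe_one, ← Filter.Germ.coe_one,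
        Filter.Germ.coe_eq]
      filter_upwards [h1.mem_nhds hx] with y hy
      exact mul_inv_cancel₀ hy.2
    · rintro ⟨_, U, f, hU, hxU, hf, rfl⟩
      obtain ⟨V, hV, haV, hVU, p, q, hpq⟩ := hf i a hxU
      refine ⟨⟨p, q, hmem_m.2 (hpq a haV).1⟩, Subtype.ext ?_⟩
      rw [Subring.coe_mul, hG, hG, ← Filter.Germ.coe_mul, Filter.Germ.coe_eq]
      have hVo := (hmor V hV).1
      filter_upwards [hVo.mem_nhds ⟨Set.mem_range_self a, by rw [Set.mem_preimage, hρ]; exact haV⟩]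
      rintro _ ⟨⟨z, rfl⟩, hz⟩
      rw [Set.mem_preimage, hρ] at hz
      obtain ⟨hq, hfz⟩ := hpq z hz
      rw [Function.comp_apply] at hfz
      rw [Pi.mul_apply, hρ, hfz, div_mul_cancel₀ _ hq]
    · intro p q hpq
      refine ⟨1, ?_⟩
      rw [Subtype.ext_iff, hG, hG, Filter.Germ.coe_eq] at hpq
      obtain ⟨U, hUpq, hU, hxU⟩ := eventually_nhds_iff.1 hpq
      have heq : p = q := eq_of_eqOn_isOpen_zariski (isOpen_glued_iff.1 hU i) ⟨a, hxU⟩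
        fun z hz => by simpa [hρ] using hUpq (ψ i z) hz
      rw [heq]
  exact IsRegularLocalRing.of_ringEquiv
    (IsLocalization.algEquiv m.primeCompl (Localization.AtPrime m)
      ((glued ψ).localRing (ψ i a))).toRingEquiv

/-- Separatedness holds if the equality of points of two charts is a polynomial condition on their
coordinates. -/
theorem isSeparatedSpace (h : IsAtlas ψ)
    (hgraph : ∀ i j, ∃ P : Set (MvPolynomial (σ i ⊕ σ j) ℝ), ∀ a b,
      ψ i a = ψ j b ↔ ∀ p ∈ P, MvPolynomial.eval (Sum.elim a b) p = 0) :
    (glued ψ).IsSeparatedSpace := by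
  intro m V _ f g hf hg
  let T := (affineSpace (Fin m)).induced V
  have hT : T.IsLocal := (isLocal_affineSpace (Fin m)).induced V
  let := T.top
  rw [← isOpen_compl_iff, isOpen_iff_forall_mem_open]
  intro v hv
  obtain ⟨i, a, ha⟩ := h.cover (f v)
  obtain ⟨j, b, hb⟩ := h.cover (g v)
  obtain ⟨P, hP⟩ := hgraph i j
  obtain ⟨p, hpP, hp⟩ : ∃ p ∈ P, MvPolynomial.eval (Sum.elim a b) p ≠ 0 := by
    by_contra hcon
    push Not at hcon
    exact hv (by rw [Set.mem_ofPred_eq, ← ha, ← hb, hP]; exact hcon)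
  obtain ⟨ρ, hρ, hρmor⟩ := h.exists_inverse i
  obtain ⟨ρ', hρ', hρmor'⟩ := h.exists_inverse j
  have hf' := hρmor.comp_isMorphism hf
  have hg' := hρmor'.comp_isMorphism hg
  have hU : IsOpen[T.top] (f ⁻¹' Set.range (ψ i) ∩ g ⁻¹' Set.range (ψ j)) :=
    hf'.isOpen.inter hg'.isOpen
  have hcoord : ∀ s, T.Regular (f ⁻¹' Set.range (ψ i) ∩ g ⁻¹' Set.range (ψ j))
      fun x => Sum.elim (ρ (f x)) (ρ' (g x)) s := by
    rintro (s | s)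
    · exact T.mono hf'.isOpen hU Set.inter_subset_left (hf'.regular_coord s)
    · exact T.mono hg'.isOpen hU Set.inter_subset_right (hg'.regular_coord s)
  refine ⟨_, ?_, (hT _ _ hU (regular_eval_comp hU hcoord p)).1, ⟨⟨a, ha⟩, ⟨b, hb⟩⟩, ?_⟩
  · rintro w ⟨⟨⟨c, hc⟩, ⟨d, hd⟩⟩, hw⟩ hfg
    rw [← hc, ← hd, hρ, hρ'] at hw
    rw [Set.mem_ofPred_eq, ← hc, ← hd, hP] at hfg
    exact hw (hfg p hpP)
  · rw [← ha, ← hb, hρ, hρ']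
    exact hp

end IsAtlas

theorem IsSeparatedSpace.of_injective {S : SpaceWithFunctions X} {T : SpaceWithFunctions Y}
    (hT : T.IsSeparatedSpace) {f : X → Y} (hf : S.IsMorphism T f) (hinj : Function.Injective f) :
    S.IsSeparatedSpace := by
  intro m V hV g h hg hh
  simpa [hinj.eq_iff] using hT m V hV _ _ (hf.comp hg) (hf.comp hh)

/-! ### Maps that embed charts in charts -/

/-- `f` maps the parametrization `φ i` to the parametrization `ψ (t i)` by the morphism `a i` of
affine spaces, which has the retraction `r i`; and the points of the range of `f` in the `t i`-th
chart have coordinates in the range of `a i`. -/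
structure IsChartwiseEmbedding (φ : ∀ i, (τ i → ℝ) → X) (ψ : ∀ i, (σ i → ℝ) → Y) (f : X → Y)
    (t : κ → ι) (a : ∀ i, (τ i → ℝ) → σ (t i) → ℝ) (r : ∀ i, (σ (t i) → ℝ) → τ i → ℝ) : Prop where
  injective : Function.Injective f
  cover : ∀ x, ∃ i, x ∈ Set.range (φ i)
  isMorphism_map : ∀ i, (affineSpace (τ i)).IsMorphism (affineSpace (σ (t i))) (a i)
  isMorphism_retraction : ∀ i, (affineSpace (σ (t i))).IsMorphism (affineSpace (τ i)) (r i)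
  retraction_map : ∀ i c, r i (a i c) = c
  map_chart : ∀ i c, f (φ i c) = ψ (t i) (a i c)
  map_retraction : ∀ i M, ψ (t i) M ∈ Set.range f → a i (r i M) = M

namespace IsChartwiseEmbedding

variable {φ : ∀ i, (τ i → ℝ) → X} {ψ : ∀ i, (σ i → ℝ) → Y} {f : X → Y}
  {t : κ → ι} {a : ∀ i, (τ i → ℝ) → σ (t i) → ℝ} {r : ∀ i, (σ (t i) → ℝ) → τ i → ℝ}

theorem isMorphism (h : IsChartwiseEmbedding φ ψ f t a r) :
    (glued φ).IsMorphism (glued ψ) f := by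
  refine isMorphism_glued_iff.2 fun i => ?_
  have h1 : f ∘ φ i = ψ (t i) ∘ a i := funext (h.map_chart i)
  rw [h1]
  exact (isMorphism_chart ψ (t i)).comp (h.isMorphism_map i)

theorem preimage_range (h : IsChartwiseEmbedding φ ψ f t a r) (i : κ) :
    f ⁻¹' Set.range (ψ (t i)) = Set.range (φ i) := by
  ext x
  constructor
  · rintro ⟨M, hM⟩
    refine ⟨r i M, h.injective ?_⟩
    rw [h.map_chart, h.map_retraction i M ⟨x, hM.symm⟩, hM]
  · rintro ⟨c, rfl⟩
    exact ⟨a i c, (h.map_chart i c).symm⟩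

/-- An atlas of the target restricts to an atlas of the source. -/
theorem isAtlas (h : IsChartwiseEmbedding φ ψ f t a r) (hψ : IsAtlas ψ) : IsAtlas φ := by
  refine ⟨h.cover, fun i => ?_⟩
  obtain ⟨ρ, hρ, hmor⟩ := hψ.exists_inverse (t i)
  refine ⟨r i ∘ ρ ∘ f, fun c => ?_, ?_⟩
  · simp [h.map_chart, hρ, h.retraction_map]
  · rw [← h.preimage_range]
    exact (h.isMorphism_retraction i).comp_isMorphismOn (hmor.comp_isMorphism h.isMorphism)

/-- On the `t i`-th chart the inverse is `φ i ∘ r i` in coordinates, hence a morphism. -/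
theorem isVarietyEmbedding (h : IsChartwiseEmbedding φ ψ f t a r) (hψ : IsAtlas ψ) :
    (glued φ).IsVarietyEmbedding (glued ψ) f := by
  refine ⟨Equiv.ofInjective f h.injective, fun _ => rfl, h.isMorphism.codRestrict, ?_⟩
  refine isMorphism_of_cover fun y => ?_
  obtain ⟨_, x, rfl⟩ := y
  obtain ⟨i, c, rfl⟩ := h.cover x
  obtain ⟨ρ, hρ, hmor⟩ := hψ.exists_inverse (t i)
  refine ⟨_, ?_, IsMorphismOn.congr (((isMorphism_chart φ i).comp
    (h.isMorphism_retraction i)).comp_isMorphismOn (hmor.comp_isMorphism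
      (isMorphism_val (glued ψ) (Set.range f)))) ?_⟩
  · exact ⟨a i c, (h.map_chart i c).symm⟩
  · rintro ⟨_, x, rfl⟩ ⟨M, hM⟩
    have hx : x ∈ Set.range (φ i) := by
      rw [← h.preimage_range]
      exact ⟨M, hM⟩
    obtain ⟨c, rfl⟩ := hx
    simp only [Function.comp_apply]
    rw [Equiv.ofInjective_symm_apply, h.map_chart, hρ, h.retraction_map]

end IsChartwiseEmbedding

/-! ### The Euclidean topology -/

/-- The topology glued from the Euclidean topologies of the charts. -/
abbrev euclideanTopology (ψ : ∀ i, (σ i → ℝ) → X) : TopologicalSpace X :=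
  ⨆ i, TopologicalSpace.coinduced (ψ i) inferInstance

theorem isOpen_euclideanTopology_iff {ψ : ∀ i, (σ i → ℝ) → X} {U : Set X} :
    IsOpen[euclideanTopology ψ] U ↔ ∀ i, IsOpen (ψ i ⁻¹' U) :=
  isOpen_iSup_iff.trans (forall_congr' fun _ => isOpen_coinduced)

theorem IsAtlas.isOpen_image_chart {ψ : ∀ i, (σ i → ℝ) → X} (h : IsAtlas ψ) (i : ι)
    {V : Set (σ i → ℝ)} (hV : IsOpen V) : IsOpen[euclideanTopology ψ] (ψ i '' V) := by
  obtain ⟨ρ, hρ, hmor⟩ := h.exists_inverse i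
  refine isOpen_euclideanTopology_iff.2 fun j => ?_
  have hmor' := hmor.comp_isMorphism (isMorphism_chart ψ j)
  have hcont : ContinuousOn (ρ ∘ ψ j) (ψ j ⁻¹' Set.range (ψ i)) :=
    continuousOn_pi.2 fun s => continuousOn_of_regular (hmor'.regular_coord s)
  have heq : ψ j ⁻¹' (ψ i '' V) = ψ j ⁻¹' Set.range (ψ i) ∩ (ρ ∘ ψ j) ⁻¹' V := by
    ext z
    constructor
    · rintro ⟨w, hw, hwz⟩
      exact ⟨⟨w, hwz⟩, by simpa [← hwz, hρ] using hw⟩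
    · rintro ⟨⟨w, hwz⟩, hw⟩
      exact ⟨w, by simpa [← hwz, hρ] using hw, hwz⟩
  rw [heq]
  exact hcont.isOpen_inter_preimage hmor'.isOpen.of_zariski hV

/-- A Zariski open and dense subset is dense in the Euclidean topology. -/
theorem IsAtlas.dense_euclidean {ψ : ∀ i, (σ i → ℝ) → X} (h : IsAtlas ψ) [∀ i, Finite (σ i)]
    {U : Set X} (hU : IsOpen[(glued ψ).top] U) (hU' : @Dense _ (glued ψ).top U) :
    @Dense _ (euclideanTopology ψ) U := by
  let := euclideanTopology ψ
  refine dense_iff_inter_open.2 fun W hW ⟨x, hx⟩ => ?_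
  obtain ⟨i, z, rfl⟩ := h.cover x
  obtain ⟨_, ⟨w, rfl⟩, hw⟩ := (@dense_iff_inter_open _ (glued ψ).top _).1 hU' _ (h.isOpen_range i)
    ⟨_, z, rfl⟩
  obtain ⟨y, hyW, hyU⟩ := (dense_of_isOpen_zariski (isOpen_glued_iff.1 hU i)
    ⟨w, hw⟩).inter_open_nonempty _ (isOpen_euclideanTopology_iff.1 hW i) ⟨z, hx⟩
  exact ⟨ψ i y, hyW, hyU⟩

/-- A chartwise embedding given by isomorphisms of the charts is an open embedding for the
Euclidean topologies. -/
theorem IsChartwiseEmbedding.isOpenEmbedding_euclidean {φ : ∀ i, (τ i → ℝ) → X}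
    {ψ : ∀ i, (σ i → ℝ) → Y} {f : X → Y} {t : κ → ι} {a : ∀ i, (τ i → ℝ) → σ (t i) → ℝ}
    {r : ∀ i, (σ (t i) → ℝ) → τ i → ℝ} (h : IsChartwiseEmbedding φ ψ f t a r) (hψ : IsAtlas ψ)
    (har : ∀ i M, a i (r i M) = M) :
    @Topology.IsOpenEmbedding _ _ (euclideanTopology φ) (euclideanTopology ψ) f := by
  let := euclideanTopology φ
  let := euclideanTopology ψ
  refine .of_continuous_injective_isOpenMap ?_ h.injective ?_
  · refine continuous_iSup_dom.2 fun i => continuous_coinduced_dom.2 ?_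
    have h1 : f ∘ φ i = ψ (t i) ∘ a i := funext (h.map_chart i)
    rw [h1]
    have h2 : Continuous (ψ (t i)) :=
      continuous_def.2 fun V hV => isOpen_euclideanTopology_iff.1 hV (t i)
    exact h2.comp (h.isMorphism_map i).continuous_euclidean
  · intro U hU
    have heq : f '' U = ⋃ i, ψ (t i) '' (r i ⁻¹' (φ i ⁻¹' U)) := by
      ext y
      simp only [Set.mem_iUnion]
      constructor
      · rintro ⟨x, hx, rfl⟩
        obtain ⟨i, c, rfl⟩ := h.cover x
        exact ⟨i, a i c, by simpa [h.retraction_map] using hx, (h.map_chart i c).symm⟩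
      · rintro ⟨i, M, hM, rfl⟩
        exact ⟨φ i (r i M), hM, by rw [h.map_chart, har]⟩
    rw [heq]
    exact isOpen_iUnion fun i => hψ.isOpen_image_chart (t i)
      ((isOpen_euclideanTopology_iff.1 hU i).preimage
        (h.isMorphism_retraction i).continuous_euclidean)

/-- The range of a chartwise embedding given by isomorphisms of the charts is a union of charts. -/
theorem IsChartwiseEmbedding.range_eq {φ : ∀ i, (τ i → ℝ) → X}
    {ψ : ∀ i, (σ i → ℝ) → Y} {f : X → Y} {t : κ → ι} {a : ∀ i, (τ i → ℝ) → σ (t i) → ℝ}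
    {r : ∀ i, (σ (t i) → ℝ) → τ i → ℝ} (h : IsChartwiseEmbedding φ ψ f t a r)
    (har : ∀ i M, a i (r i M) = M) : Set.range f = ⋃ i, Set.range (ψ (t i)) := by
  ext y
  simp only [Set.mem_iUnion]
  constructor
  · rintro ⟨x, rfl⟩
    obtain ⟨i, c, rfl⟩ := h.cover x
    exact ⟨i, a i c, (h.map_chart i c).symm⟩
  · rintro ⟨i, M, rfl⟩
    exact ⟨φ i (r i M), by rw [h.map_chart, har]⟩

end SpaceWithFunctions

/-! ### The standard charts of the Grassmannian -/

section Charts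

variable {k n : ℕ}

theorem mem_range_normalizedFrame (I : Finset (Fin n)) (M : {i // i ∉ I} × {i // i ∈ I} → ℝ)
    (v : Fin n → ℝ) : v ∈ LinearMap.range (normalizedFrame I M) ↔
      ∀ i : {i // i ∉ I}, v i = ∑ j : {i // i ∈ I}, M (i, j) * v j := by
  constructor
  · rintro ⟨u, rfl⟩ i
    simp [normalizedFrame, i.2]
  · intro h
    refine ⟨fun j => v j, funext fun i => ?_⟩
    by_cases hi : i ∈ I
    · simp [normalizedFrame, hi]
    · simp [normalizedFrame, hi, h ⟨i, hi⟩]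

theorem mem_grChart (I : RowSet k n) (M : {i // i ∉ I.1} × {i // i ∈ I.1} → ℝ) (v : Fin n → ℝ) :
    v ∈ (grChart I M).1 ↔ ∀ i : {i // i ∉ I.1}, v i = ∑ j : {i // i ∈ I.1}, M (i, j) * v j :=
  mem_range_normalizedFrame I.1 M v

/-- The entries of the `n × k` matrix whose `I`-rows form the identity matrix, as polynomials in
its other entries. -/
noncomputable def frameEntry (I : Finset (Fin n)) (i : Fin n) (j : {i // i ∈ I}) :
    MvPolynomial ({i // i ∉ I} × {i // i ∈ I}) ℝ :=
  if h : i ∈ I then if (⟨i, h⟩ : {i // i ∈ I}) = j then 1 else 0 else MvPolynomial.X (⟨i, h⟩, j)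

theorem eval_frameEntry_of_mem (I : Finset (Fin n)) (i j : {i // i ∈ I})
    (M : {i // i ∉ I} × {i // i ∈ I} → ℝ) :
    MvPolynomial.eval M (frameEntry I i j) = if i = j then 1 else 0 := by
  rw [frameEntry, dif_pos i.2]
  split_ifs <;> simp

theorem eval_frameEntry_of_notMem (I : Finset (Fin n)) (i : {i // i ∉ I}) (j : {i // i ∈ I})
    (M : {i // i ∉ I} × {i // i ∈ I} → ℝ) :
    MvPolynomial.eval M (frameEntry I i j) = M (i, j) := by
  rw [frameEntry, dif_neg i.2, MvPolynomial.eval_X]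

theorem normalizedFrame_apply (I : Finset (Fin n)) (M : {i // i ∉ I} × {i // i ∈ I} → ℝ)
    (u : {i // i ∈ I} → ℝ) (i : Fin n) :
    normalizedFrame I M u i = ∑ j, MvPolynomial.eval M (frameEntry I i j) * u j := by
  by_cases hi : i ∈ I
  · have h j := eval_frameEntry_of_mem I ⟨i, hi⟩ j M
    simp only at h
    simp [h, normalizedFrame, hi]
  · have h j := eval_frameEntry_of_notMem I ⟨i, hi⟩ j M
    simp only at h
    simp [h, normalizedFrame, hi]

theorem column_mem_grChart (I : RowSet k n) (M : {i // i ∉ I.1} × {i // i ∈ I.1} → ℝ)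
    (j : {i // i ∈ I.1}) :
    (fun i => MvPolynomial.eval M (frameEntry I.1 i j)) ∈ (grChart I M).1 := by
  rw [mem_grChart]
  intro i
  simp [eval_frameEntry_of_notMem, eval_frameEntry_of_mem]

theorem Gr.eq_of_le {A B : Gr k n} (h : A.1 ≤ B.1) : A = B :=
  Subtype.ext (Submodule.eq_of_le_of_finrank_eq h (A.2.trans B.2.symm))

theorem grChart_eq_iff (I : RowSet k n) (M : {i // i ∉ I.1} × {i // i ∈ I.1} → ℝ) (B : Gr k n) :
    grChart I M = B ↔ ∀ j, (fun i => MvPolynomial.eval M (frameEntry I.1 i j)) ∈ B.1 := by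
  constructor
  · rintro rfl j
    exact column_mem_grChart I M j
  · intro h
    refine Gr.eq_of_le ?_
    rintro _ ⟨u, rfl⟩
    have : normalizedFrame I.1 M u =
        ∑ j, u j • fun i => MvPolynomial.eval M (frameEntry I.1 i j) := by
      funext i
      simp [normalizedFrame_apply, mul_comm]
    rw [this]
    exact Submodule.sum_mem _ fun j _ => Submodule.smul_mem _ _ (h j)

theorem grChart_injective (I : RowSet k n) : Function.Injective (grChart I) := by
  intro M N h
  funext ⟨i, j⟩
  have h' := (mem_grChart I N _).1 ((grChart_eq_iff I M _).1 h j) i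
  simpa [eval_frameEntry_of_notMem, eval_frameEntry_of_mem] using h'

/-- A subspace lies in the `I`-th standard chart if and only if its projection to the coordinates
in `I` is injective. -/
theorem mem_range_grChart_iff (I : RowSet k n) (A : Gr k n) :
    A ∈ Set.range (grChart I) ↔ ∀ v ∈ A.1, (∀ i ∈ I.1, v i = 0) → v = 0 := by
  constructor
  · rintro ⟨M, rfl⟩ v hv h0
    funext i
    by_cases hi : i ∈ I.1
    · exact h0 i hi
    · rw [(mem_grChart I M v).1 hv ⟨i, hi⟩]
      exact Finset.sum_eq_zero fun j _ => by rw [h0 j j.2, mul_zero]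
  · intro h
    let L : A.1 →ₗ[ℝ] ({i // i ∈ I.1} → ℝ) :=
      (LinearMap.funLeft ℝ ℝ Subtype.val).comp A.1.subtype
    have hL : Function.Injective L := by
      refine (injective_iff_map_eq_zero L).2 fun v hv => Subtype.ext (h v v.2 fun i hi => ?_)
      exact congrFun hv ⟨i, hi⟩
    let e := L.linearEquivOfInjective hL (by rw [A.2]; simp [I.2])
    have he : ∀ u (j : {i // i ∈ I.1}), (e.symm u).1 j = u j := fun u j =>
      congrFun (e.apply_symm_apply u) j
    refine ⟨fun p => (e.symm (Pi.single p.2 1)).1 p.1, (grChart_eq_iff I _ A).2 fun j => ?_⟩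
    convert (e.symm (Pi.single j 1)).2 using 1
    funext i
    by_cases hi : i ∈ I.1
    · rw [he _ ⟨i, hi⟩]
      exact (eval_frameEntry_of_mem I.1 ⟨i, hi⟩ j _).trans (by simp [Pi.single_apply])
    · exact eval_frameEntry_of_notMem I.1 ⟨i, hi⟩ j _

/-- Among the coordinate functions, which span the dual of `A`, there is a basis. -/
theorem exists_mem_range_grChart (A : Gr k n) : ∃ I : RowSet k n, A ∈ Set.range (grChart I) := by
  let f : Fin n → Module.Dual ℝ A.1 := fun i => (LinearMap.proj i).comp A.1.subtype
  have hspan : Submodule.span ℝ (Set.range f) = ⊤ := by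
    have h1 := Subspace.finrank_add_finrank_dualCoannihilator_eq (Submodule.span ℝ (Set.range f))
    have h2 : (Submodule.span ℝ (Set.range f)).dualCoannihilator = ⊥ := by
      refine (Submodule.eq_bot_iff _).2 fun v hv => Subtype.ext (funext fun i => ?_)
      exact (Submodule.mem_dualCoannihilator v).1 hv (f i)
        (Submodule.subset_span (Set.mem_range_self i))
    rw [h2, finrank_bot, add_zero] at h1
    exact Submodule.eq_top_of_finrank_eq (h1.trans Subspace.dual_finrank_eq.symm)
  obtain ⟨κ, a, ha, hspan', hli⟩ := exists_linearIndependent' ℝ f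
  have : Finite κ := Finite.of_injective a ha
  have := Fintype.ofFinite κ
  have hcard : Fintype.card κ = k := by
    rw [← finrank_span_eq_card hli, hspan', hspan, finrank_top, Subspace.dual_finrank_eq, A.2]
  refine ⟨⟨Finset.univ.map ⟨a, ha⟩, by simpa using hcard⟩, (mem_range_grChart_iff _ _).2 ?_⟩
  intro v hv h0
  have hker : Submodule.span ℝ (Set.range (f ∘ a)) ≤
      LinearMap.ker (Module.Dual.eval ℝ A.1 ⟨v, hv⟩) := by
    rw [Submodule.span_le]
    rintro _ ⟨l, rfl⟩
    exact h0 (a l) (by simp)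
  rw [hspan', hspan] at hker
  funext i
  exact hker (Submodule.mem_top (x := f i))

/-- Some subspace lies in all standard charts: the space of the values of the polynomials of degree
less than `k` at the points `0, …, n - 1`. -/
theorem exists_forall_mem_range_grChart (h : k ≤ n) :
    ∃ A : Gr k n, ∀ I, A ∈ Set.range (grChart I) := by
  let L : Polynomial.degreeLT ℝ k →ₗ[ℝ] (Fin n → ℝ) :=
    LinearMap.pi fun i => (Polynomial.leval (i : ℝ)).comp (Polynomial.degreeLT ℝ k).subtype
  have hzero : ∀ (s : Finset (Fin n)) (p : Polynomial.degreeLT ℝ k), k ≤ s.card →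
      (∀ i ∈ s, L p i = 0) → p = 0 := by
    intro s p hs hp
    refine Subtype.ext (Polynomial.eq_zero_of_degree_lt_of_eval_index_eq_zero
      (v := fun i : Fin n => (i : ℝ)) (s := s)
      (fun i _ j _ hij => ?_) ?_ hp)
    · exact Fin.ext (Nat.cast_injective hij)
    · exact (Polynomial.mem_degreeLT.1 p.2).trans_le (by exact_mod_cast hs)
  have hL : Function.Injective L := by
    refine (injective_iff_map_eq_zero L).2 fun p hp => hzero Finset.univ p (by simpa using h) ?_
    exact fun i _ => congrFun hp i
  refine ⟨⟨LinearMap.range L, ?_⟩, fun I => (mem_range_grChart_iff _ _).2 ?_⟩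
  · rw [LinearMap.finrank_range_of_inj hL, (Polynomial.degreeLTEquiv ℝ k).finrank_eq]
    simp
  · rintro _ ⟨p, rfl⟩ hp
    rw [hzero I.1 p I.2.ge hp, map_zero]

/-- The transition from the `J`-th to the `I`-th chart: on the locus where the `I`-rows `B` of the
`J`-normalized matrix `X` are invertible, the `I`-coordinates are the entries of `X * B⁻¹`, by
Cramer's rule quotients of polynomials by `det B`. -/
theorem exists_transition (I J : RowSet k n) :
    ∃ (q : MvPolynomial ({i // i ∉ J.1} × {i // i ∈ J.1}) ℝ)
      (p : {i // i ∉ I.1} × {i // i ∈ I.1} → MvPolynomial ({i // i ∉ J.1} × {i // i ∈ J.1}) ℝ),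
      (∀ z, grChart J z ∈ Set.range (grChart I) ↔ MvPolynomial.eval z q ≠ 0) ∧
      ∀ z M, grChart J z = grChart I M → ∀ s,
        M s = MvPolynomial.eval z (p s) / MvPolynomial.eval z q := by
  have hcard : Fintype.card {i // i ∈ I.1} = Fintype.card {i // i ∈ J.1} := by
    simp [I.2, J.2]
  let e : {i // i ∈ I.1} ≃ {i // i ∈ J.1} := Fintype.equivOfCardEq hcard
  let B : Matrix {i // i ∈ I.1} {i // i ∈ I.1} (MvPolynomial ({i // i ∉ J.1} × {i // i ∈ J.1}) ℝ) :=
    Matrix.of fun i j => frameEntry J.1 i (e j)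
  have hdet : ∀ z, MvPolynomial.eval z B.det = ((MvPolynomial.eval z).mapMatrix B).det :=
    fun z => RingHom.map_det _ _
  have hiff : ∀ z, grChart J z ∈ Set.range (grChart I) ↔ MvPolynomial.eval z B.det ≠ 0 := by
    intro z
    have hmul : ∀ (u : {i // i ∈ J.1} → ℝ) (i : {i // i ∈ I.1}),
        normalizedFrame J.1 z u i = ((MvPolynomial.eval z).mapMatrix B).mulVec (u ∘ e) i := by
      intro u i
      rw [normalizedFrame_apply]
      exact (Equiv.sum_comp e fun j => MvPolynomial.eval z (frameEntry J.1 i j) * u j).symm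
    rw [mem_range_grChart_iff, hdet, ne_eq, ← Matrix.exists_mulVec_eq_zero_iff]
    constructor
    · rintro h ⟨u, hu0, hu⟩
      refine hu0 ?_
      have h0 := h (normalizedFrame J.1 z (u ∘ e.symm)) ⟨_, rfl⟩ fun i hi => by
        rw [hmul _ ⟨i, hi⟩, Function.comp_assoc, e.symm_comp_self, Function.comp_id, hu]
        rfl
      have h1 := normalizedFrame_injective J.1 z (h0.trans (map_zero _).symm)
      funext i
      simpa using congrFun h1 (e i)
    · rintro h _ ⟨u, rfl⟩ hu
      by_contra hne
      refine h ⟨u ∘ e, fun h0 => hne ?_, funext fun i => ?_⟩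
      · have : u = 0 := funext fun j => by simpa using congrFun h0 (e.symm j)
        exact this ▸ map_zero _
      · rw [← hmul]
        exact hu i i.2
  refine ⟨B.det, fun s => ∑ l, frameEntry J.1 s.1 (e l) * B.adjugate l s.2, hiff, ?_⟩
  rintro z M h ⟨i, j⟩
  have hq : MvPolynomial.eval z B.det ≠ 0 := (hiff z).1 ⟨M, h.symm⟩
  -- The columns of `X` satisfy the equations of `grChart I M`: the row `i` of `X` is `M i * B`.
  have hcol : ∀ l, MvPolynomial.eval z (frameEntry J.1 i (e l)) =
      ∑ m, M (i, m) * MvPolynomial.eval z (B m l) := fun l =>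
    (mem_grChart I M _).1 ((grChart_eq_iff J z _).1 h (e l)) i
  have hadj : ∀ m, ∑ l, MvPolynomial.eval z (B m l) * MvPolynomial.eval z (B.adjugate l j) =
      if m = j then MvPolynomial.eval z B.det else 0 := by
    intro m
    have h1 := congrFun (congrFun B.mul_adjugate m) j
    rw [Matrix.mul_apply] at h1
    have h2 := congrArg (MvPolynomial.eval z) h1
    rw [map_sum] at h2
    simp only [map_mul] at h2
    rw [h2, Matrix.smul_apply, Matrix.one_apply]
    split_ifs <;> simp
  rw [eq_div_iff hq, map_sum]
  simp only [map_mul, hcol, Finset.sum_mul]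
  rw [Finset.sum_comm]
  simp only [mul_assoc, ← Finset.mul_sum, hadj]
  simp

theorem isAtlas_grChart : SpaceWithFunctions.IsAtlas fun I : RowSet k n => grChart I := by
  refine ⟨exists_mem_range_grChart, fun I => ⟨Function.invFun (grChart I),
    Function.leftInverse_invFun (grChart_injective I), ?_⟩⟩
  have hopen : ∀ J : RowSet k n, IsOpen[zariskiTopology _] (grChart J ⁻¹' Set.range (grChart I)) :=
    fun J => by
      obtain ⟨q, p, hq, -⟩ := exists_transition I J
      convert isOpen_eval_ne_zero q using 1
      exact Set.ext hq
  refine (SpaceWithFunctions.isLocal_glued _).isMorphismOn_affineSpace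
    (SpaceWithFunctions.isOpen_glued_iff.2 hopen) fun s J z hz => ?_
  obtain ⟨q, p, hq, hp⟩ := exists_transition I J
  exact ⟨_, hopen J, hz, subset_rfl, p s, q, fun w hw =>
    ⟨(hq w).1 hw, hp w _ (Function.invFun_eq hw).symm s⟩⟩

/-- The range of one normalized matrix lies in the range of another, with `J`-rows the identity, if
its columns satisfy the linear equations of the latter: polynomial equations in the entries. -/
theorem isSeparatedSpace_grVariety : (grVariety k n).IsSeparatedSpace := by
  refine isAtlas_grChart.isSeparatedSpace fun I J => ?_
  refine ⟨Set.range fun p : {i // i ∉ J.1} × {i // i ∈ I.1} =>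
    MvPolynomial.rename Sum.inl (frameEntry I.1 p.1 p.2) -
      ∑ l : {i // i ∈ J.1}, MvPolynomial.X (Sum.inr (p.1, l)) *
        MvPolynomial.rename Sum.inl (frameEntry I.1 l p.2), fun a b => ?_⟩
  rw [grChart_eq_iff, Set.forall_mem_range, Prod.forall, forall_comm]
  refine forall_congr' fun j => (mem_grChart J b _).trans (forall_congr' fun i => ?_)
  simp [sub_eq_zero, MvPolynomial.eval_rename]

theorem isIrreducibleVariety_grVariety (h : k ≤ n) : (grVariety k n).IsIrreducibleVariety := by
  obtain ⟨A, hA⟩ := exists_forall_mem_range_grChart h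
  exact isAtlas_grChart.isIrreducibleVariety hA

end Charts

/-! ### The last coordinate of `ℝ^(n+1)` -/

section LastCoordinate

variable {n : ℕ} {P : Fin n → Prop} {Q : Fin (n + 1) → Prop}

/-- If `Q` fails at the last index, it has the same elements as its restriction `P`. -/
noncomputable def subtypeCastSuccEquiv (h : ∀ i, Q i.castSucc ↔ P i) (hl : ¬ Q (Fin.last n)) :
    {i // P i} ≃ {i // Q i} :=
  Equiv.ofBijective (fun i => ⟨i.1.castSucc, (h i.1).2 i.2⟩) <| by
    constructor
    · intro i j hij
      exact Subtype.ext (Fin.castSucc_injective n (congrArg Subtype.val hij))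
    · rintro ⟨i, hi⟩
      induction i using Fin.lastCases with
      | last => exact absurd hi hl
      | cast i => exact ⟨⟨i, (h i).1 hi⟩, rfl⟩

/-- If `Q` holds at the last index, it has one element more than its restriction `P`. -/
noncomputable def optionCastSuccEquiv (h : ∀ i, Q i.castSucc ↔ P i) (hl : Q (Fin.last n)) :
    Option {i // P i} ≃ {i // Q i} :=
  Equiv.ofBijective
    (fun o => o.elim ⟨Fin.last n, hl⟩ fun i => ⟨i.1.castSucc, (h i.1).2 i.2⟩) <| by
    constructor
    · rintro (_ | i) (_ | j) hij
      · rfl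
      · exact absurd (congrArg Subtype.val hij).symm (Fin.castSucc_ne_last j.1)
      · exact absurd (congrArg Subtype.val hij) (Fin.castSucc_ne_last i.1)
      · exact congrArg some
          (Subtype.ext (Fin.castSucc_injective n (congrArg Subtype.val hij)))
    · rintro ⟨i, hi⟩
      induction i using Fin.lastCases with
      | last => exact ⟨none, rfl⟩
      | cast i => exact ⟨some ⟨i, (h i).1 hi⟩, rfl⟩

theorem coe_optionCastSuccEquiv_none (h : ∀ i, Q i.castSucc ↔ P i) (hl : Q (Fin.last n)) :
    (optionCastSuccEquiv h hl none : Fin (n + 1)) = Fin.last n := rfl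

theorem mem_range_inclLast {w : Fin (n + 1) → ℝ} :
    w ∈ LinearMap.range (inclLast n) ↔ w (Fin.last n) = 0 := by
  constructor
  · rintro ⟨x, rfl⟩
    simp [inclLast]
  · intro h
    refine ⟨Fin.init w, ?_⟩
    change Fin.snoc (Fin.init w) 0 = w
    rw [← h, Fin.snoc_init_self]

theorem inclLast_injective : Function.Injective (inclLast n) := by
  intro x y h
  funext i
  simpa [inclLast] using congrFun h i.castSucc

theorem mem_map_inclLast {A : Submodule ℝ (Fin n → ℝ)} {w : Fin (n + 1) → ℝ} :
    w ∈ A.map (inclLast n) ↔ w (Fin.last n) = 0 ∧ (fun i => w i.castSucc) ∈ A := by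
  constructor
  · rintro ⟨x, hx, rfl⟩
    simpa [inclLast] using hx
  · rintro ⟨h, hw⟩
    refine ⟨_, hw, ?_⟩
    change Fin.snoc (Fin.init w) 0 = w
    rw [← h, Fin.snoc_init_self]

end LastCoordinate

/-! ### Charts of `Gr(k, n + 1)` with and without the last row -/

section RowSets

variable {k n : ℕ}

/-- The rows of `I` together with the last row. -/
def RowSet.withLast (I : RowSet k n) : RowSet (k + 1) (n + 1) :=
  ⟨Finset.cons (Fin.last n) (I.1.map Fin.castSuccEmb) (by simp), by simp [I.2]⟩

/-- The rows of `I` as rows of a matrix with one more row. -/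
def RowSet.withoutLast (I : RowSet k n) : RowSet k (n + 1) :=
  ⟨I.1.map Fin.castSuccEmb, by simp [I.2]⟩

theorem RowSet.castSucc_mem_withLast (I : RowSet k n) (i : Fin n) :
    i.castSucc ∈ I.withLast.1 ↔ i ∈ I.1 := by
  simp [RowSet.withLast]

theorem RowSet.last_mem_withLast (I : RowSet k n) : Fin.last n ∈ I.withLast.1 := by
  simp [RowSet.withLast]

theorem RowSet.castSucc_mem_withoutLast (I : RowSet k n) (i : Fin n) :
    i.castSucc ∈ I.withoutLast.1 ↔ i ∈ I.1 := by
  simp [RowSet.withoutLast]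

theorem RowSet.last_notMem_withoutLast (I : RowSet k n) : Fin.last n ∉ I.withoutLast.1 := by
  simp [RowSet.withoutLast]

theorem RowSet.exists_eq_withLast (I : RowSet (k + 1) (n + 1)) (h : Fin.last n ∈ I.1) :
    ∃ J : RowSet k n, J.withLast = I := by
  let J : Finset (Fin n) := I.1.preimage Fin.castSucc (Fin.castSucc_injective n).injOn
  have hJ : Finset.cons (Fin.last n) (J.map Fin.castSuccEmb) (by simp) = I.1 := by
    ext i
    induction i using Fin.lastCases with
    | last => simpa using h
    | cast i => simp [J]
  have hcard := congrArg Finset.card hJ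
  rw [Finset.card_cons, Finset.card_map, I.2] at hcard
  exact ⟨⟨J, Nat.succ_injective hcard⟩, Subtype.ext hJ⟩

/-- The columns of `I.withLast`. -/
noncomputable abbrev RowSet.withLastCol (I : RowSet k n) :
    Option {i // i ∈ I.1} ≃ {i // i ∈ I.withLast.1} :=
  optionCastSuccEquiv I.castSucc_mem_withLast I.last_mem_withLast

/-- The free rows of `I.withLast`. -/
noncomputable abbrev RowSet.withLastRow (I : RowSet k n) :
    {i // i ∉ I.1} ≃ {i // i ∉ I.withLast.1} :=
  subtypeCastSuccEquiv (fun i => not_congr (I.castSucc_mem_withLast i))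
    (not_not_intro I.last_mem_withLast)

/-- The columns of `I.withoutLast`. -/
noncomputable abbrev RowSet.withoutLastCol (I : RowSet k n) :
    {i // i ∈ I.1} ≃ {i // i ∈ I.withoutLast.1} :=
  subtypeCastSuccEquiv I.castSucc_mem_withoutLast I.last_notMem_withoutLast

/-- The free rows of `I.withoutLast`. -/
noncomputable abbrev RowSet.withoutLastRow (I : RowSet k n) :
    Option {i // i ∉ I.1} ≃ {i // i ∉ I.withoutLast.1} :=
  optionCastSuccEquiv (fun i => not_congr (I.castSucc_mem_withoutLast i))
    I.last_notMem_withoutLast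

theorem mem_grChart_withLast (I : RowSet k n)
    (M : {i // i ∉ I.withLast.1} × {i // i ∈ I.withLast.1} → ℝ) (w : Fin (n + 1) → ℝ) :
    w ∈ (grChart I.withLast M).1 ↔ ∀ i : {i // i ∉ I.1}, w i.1.castSucc =
      M (I.withLastRow i, I.withLastCol none) * w (Fin.last n) +
        ∑ j : {i // i ∈ I.1}, M (I.withLastRow i, I.withLastCol (some j)) * w j.1.castSucc := by
  rw [mem_grChart, ← I.withLastRow.forall_congr_right]
  refine forall_congr' fun i => ?_
  rw [← I.withLastCol.sum_comp, Fintype.sum_option]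
  rfl

theorem mem_grChart_withoutLast (I : RowSet k n)
    (M : {i // i ∉ I.withoutLast.1} × {i // i ∈ I.withoutLast.1} → ℝ) (w : Fin (n + 1) → ℝ) :
    w ∈ (grChart I.withoutLast M).1 ↔
      w (Fin.last n) = ∑ j : {i // i ∈ I.1},
        M (I.withoutLastRow none, I.withoutLastCol j) * w j.1.castSucc ∧
      ∀ i : {i // i ∉ I.1}, w i.1.castSucc = ∑ j : {i // i ∈ I.1},
        M (I.withoutLastRow (some i), I.withoutLastCol j) * w j.1.castSucc := by
  rw [mem_grChart, ← I.withoutLastRow.forall_congr_right, Option.forall]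
  refine and_congr ?_ (forall_congr' fun i => ?_) <;>
  · rw [← I.withoutLastCol.sum_comp]
    rfl

end RowSets

/-! ### The affine Grassmannian as an open subset of a Grassmannian -/

section Homogenization

variable {k n : ℕ}

theorem mem_graffChart (I : RowSet k n)
    (c : {i // i ∉ I.1} × Option {i // i ∈ I.1} → ℝ) (x : Fin n → ℝ) :
    x ∈ (graffChart I c).1 ↔ ∀ i : {i // i ∉ I.1},
      x i = c (i, none) + ∑ j : {i // i ∈ I.1}, c (i, some j) * x j := by
  change x ∈ AffineSubspace.mk' _ _ ↔ _
  rw [AffineSubspace.mem_mk', mem_range_normalizedFrame]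
  refine forall_congr' fun i => ?_
  simp [normalizedDisplacement, i.2, sub_eq_iff_eq_add']

theorem direction_graffChart (I : RowSet k n)
    (c : {i // i ∉ I.1} × Option {i // i ∈ I.1} → ℝ) :
    (graffChart I c).1.direction =
      LinearMap.range (normalizedFrame I.1 fun p => c (p.1, some p.2)) :=
  AffineSubspace.direction_mk' _ _

theorem exists_mem_range_graffChart (S : Graff k n) :
    ∃ I : RowSet k n, S ∈ Set.range (graffChart I) := by
  obtain ⟨b, hb⟩ := S.2.1
  obtain ⟨I, M, hM⟩ := exists_mem_range_grChart (⟨S.1.direction, S.2.2⟩ : Gr k n)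
  have hM' : (grChart I M).1 = S.1.direction := congrArg Subtype.val hM
  refine ⟨I, fun p => p.2.elim (b p.1 - ∑ j, M (p.1, j) * b j) fun j => M (p.1, j),
    Subtype.ext (AffineSubspace.ext fun x => ?_)⟩
  rw [mem_graffChart, ← AffineSubspace.vsub_right_mem_direction_iff_mem hb, ← hM', mem_grChart]
  refine forall_congr' fun i => ?_
  simp only [Option.elim, vsub_eq_sub, Pi.sub_apply, mul_sub, Finset.sum_sub_distrib]
  constructor <;> intro h <;> linarith

/-- The linear subspace of `ℝ^(n+1)` spanned by `D` and `(b, 1)`: it consists of the `w` such that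
`(w_1, …, w_n) - w_(n+1) • b` lies in `D`. -/
def cone (D : Submodule ℝ (Fin n → ℝ)) (b : Fin n → ℝ) : Submodule ℝ (Fin (n + 1) → ℝ) :=
  D.comap (LinearMap.pi fun i => LinearMap.proj i.castSucc - b i • LinearMap.proj (Fin.last n))

theorem mem_cone {D : Submodule ℝ (Fin n → ℝ)} {b : Fin n → ℝ} {w : Fin (n + 1) → ℝ} :
    w ∈ cone D b ↔ (fun i => w i.castSucc - b i * w (Fin.last n)) ∈ D :=
  Iff.rfl

theorem cone_eq_span (D : Submodule ℝ (Fin n → ℝ)) (b : Fin n → ℝ) :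
    cone D b = Submodule.span ℝ (inclLast n '' (D : Set (Fin n → ℝ)) ∪
      {inclLast n b + Pi.single (Fin.last n) 1}) := by
  apply le_antisymm
  · intro w hw
    have h : w = inclLast n (fun i => w i.castSucc - b i * w (Fin.last n)) +
        w (Fin.last n) • (inclLast n b + Pi.single (Fin.last n) 1) := by
      funext i
      induction i using Fin.lastCases with
      | last => simp [inclLast]
      | cast i => simp [inclLast, Fin.castSucc_ne_last, mul_comm]
    rw [h]
    exact Submodule.add_mem _ (Submodule.subset_span (Or.inl ⟨_, mem_cone.1 hw, rfl⟩))
      (Submodule.smul_mem _ _ (Submodule.subset_span (Or.inr rfl)))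
  · rw [Submodule.span_le]
    rintro _ (⟨d, hd, rfl⟩ | rfl)
    · rw [SetLike.mem_coe, mem_cone]
      simpa [inclLast] using hd
    · rw [SetLike.mem_coe, mem_cone]
      convert D.zero_mem using 1
      funext i
      simp [inclLast, Fin.castSucc_ne_last]

/-- The affine coordinates `c` of `S` in the `I`-th chart are the linear coordinates of the cone
over `S` in the chart of the rows of `I` and the last row: the normalized matrix of the cone is
`[X, y; 0, 1]`. -/
theorem cone_graffChart (I : RowSet k n) (c : {i // i ∉ I.1} × Option {i // i ∈ I.1} → ℝ)
    {b : Fin n → ℝ} (hb : b ∈ (graffChart I c).1) :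
    cone (graffChart I c).1.direction b =
      (grChart I.withLast fun p => c (I.withLastRow.symm p.1, I.withLastCol.symm p.2)).1 := by
  ext w
  rw [mem_cone, direction_graffChart, mem_range_normalizedFrame, mem_grChart_withLast]
  refine forall_congr' fun i => ?_
  have hbi := (mem_graffChart I c b).1 hb i
  simp only [Equiv.symm_apply_apply, mul_sub, Finset.sum_sub_distrib, ← mul_assoc,
    ← Finset.sum_mul]
  rw [hbi]
  constructor <;> intro h <;> linarith

theorem finrank_cone (S : Graff k n) {b : Fin n → ℝ} (hb : b ∈ S.1) :
    Module.finrank ℝ (cone S.1.direction b) = k + 1 := by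
  obtain ⟨I, c, rfl⟩ := exists_mem_range_graffChart S
  rw [cone_graffChart I c hb]
  exact (grChart I.withLast _).2

/-- The embedding of `Graff(k, n)` into `Gr(k + 1, n + 1)`: an affine subspace is mapped to the
cone over its copy in the hyperplane `x_(n+1) = 1`. -/
noncomputable def homogenization (S : Graff k n) : Gr (k + 1) (n + 1) :=
  ⟨cone S.1.direction S.2.1.some, finrank_cone S S.2.1.some_mem⟩

theorem homogenization_graffChart (I : RowSet k n)
    (c : {i // i ∉ I.1} × Option {i // i ∈ I.1} → ℝ) :
    homogenization (graffChart I c) =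
      grChart I.withLast fun p => c (I.withLastRow.symm p.1, I.withLastCol.symm p.2) :=
  Subtype.ext (cone_graffChart I c (graffChart I c).2.1.some_mem)

theorem homogenization_eq_cone (S : Graff k n) {b : Fin n → ℝ} (hb : b ∈ S.1) :
    (homogenization S).1 = cone S.1.direction b := by
  obtain ⟨I, c, rfl⟩ := exists_mem_range_graffChart S
  rw [homogenization_graffChart, cone_graffChart I c hb]

theorem mem_iff_snoc_mem_homogenization (S : Graff k n) (x : Fin n → ℝ) :
    x ∈ S.1 ↔ (Fin.snoc x 1 : Fin (n + 1) → ℝ) ∈ (homogenization S).1 := by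
  obtain ⟨b, hb⟩ := S.2.1
  rw [homogenization_eq_cone S hb, mem_cone,
    ← AffineSubspace.vsub_right_mem_direction_iff_mem hb]
  simp only [Fin.snoc_castSucc, Fin.snoc_last, mul_one]
  rfl

theorem homogenization_injective :
    Function.Injective (homogenization : Graff k n → Gr (k + 1) (n + 1)) := by
  intro S T h
  refine Subtype.ext (AffineSubspace.ext fun x => ?_)
  rw [mem_iff_snoc_mem_homogenization, h, ← mem_iff_snoc_mem_homogenization]

theorem isChartwiseEmbedding_homogenization :
    SpaceWithFunctions.IsChartwiseEmbedding (fun I : RowSet k n => graffChart I)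
      (fun I : RowSet (k + 1) (n + 1) => grChart I) homogenization RowSet.withLast
      (fun I c p => c (I.withLastRow.symm p.1, I.withLastCol.symm p.2))
      (fun I M p => M (I.withLastRow p.1, I.withLastCol p.2)) where
  injective := homogenization_injective
  cover := exists_mem_range_graffChart
  isMorphism_map I := SpaceWithFunctions.isMorphism_of_eval fun p =>
    ⟨MvPolynomial.X (I.withLastRow.symm p.1, I.withLastCol.symm p.2), fun z => by simp⟩
  isMorphism_retraction I := SpaceWithFunctions.isMorphism_of_eval fun p =>
    ⟨MvPolynomial.X (I.withLastRow p.1, I.withLastCol p.2), fun z => by simp⟩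
  retraction_map I c := by simp
  map_chart := homogenization_graffChart
  map_retraction I M _ := by simp

/-- The range of the homogenization is the union of the charts whose rows contain the last one; a
subspace that does not lie in `E_n` is in such a chart, by exchanging a row for the last one. -/
theorem compl_range_homogenization :
    (Set.range (homogenization : Graff k n → Gr (k + 1) (n + 1)))ᶜ =
      {B : Gr (k + 1) (n + 1) | B.1 ≤ LinearMap.range (inclLast n)} := by
  rw [isChartwiseEmbedding_homogenization.range_eq fun I M => by simp]
  ext B
  simp only [Set.mem_compl_iff, Set.mem_iUnion, Set.mem_ofPred_eq]
  constructor
  · intro h w hw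
    rw [mem_range_inclLast]
    by_contra hw0
    obtain ⟨I, M, rfl⟩ := exists_mem_range_grChart B
    by_cases hI : Fin.last n ∈ I.1
    · obtain ⟨J, rfl⟩ := I.exists_eq_withLast hI
      exact h ⟨J, M, rfl⟩
    have hlast : ∀ v ∈ (grChart I M).1, v (Fin.last n) =
        ∑ j : {i // i ∈ I.1}, M (⟨Fin.last n, hI⟩, j) * v j :=
      fun v hv => (mem_grChart I M v).1 hv ⟨Fin.last n, hI⟩
    -- The last coordinate does not vanish on `B`, so some coordinate `j` in `I` can be replaced
    -- by it.
    obtain ⟨j, hj⟩ : ∃ j, M (⟨Fin.last n, hI⟩, j) ≠ 0 := by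
      by_contra hcon
      push Not at hcon
      exact hw0 (by rw [hlast w hw]; simp [hcon])
    have hmem : Fin.last n ∉ I.1.erase j.1 := fun h' => hI (Finset.mem_of_mem_erase h')
    let I' : RowSet (k + 1) (n + 1) := ⟨Finset.cons (Fin.last n) (I.1.erase j.1) hmem, by
      rw [Finset.card_cons, Finset.card_erase_of_mem j.2, I.2, Nat.add_sub_cancel]⟩
    obtain ⟨J, hJ⟩ := I'.exists_eq_withLast (by simp [I'])
    refine h ⟨J, ?_⟩
    rw [hJ, mem_range_grChart_iff]
    intro v hv h0
    have herase : ∀ i ∈ I.1, i ≠ j.1 → v i = 0 := fun i hi hij =>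
      h0 i (by simp [I', hij, hi])
    have hvl := hlast v hv
    rw [h0 (Fin.last n) (by simp [I']), Finset.sum_eq_single j
      (fun i _ hij => by rw [herase i i.2 fun h' => hij (Subtype.ext h'), mul_zero])
      (fun h' => absurd (Finset.mem_univ j) h')] at hvl
    have hvj : v j = 0 := (mul_eq_zero.1 hvl.symm).resolve_left hj
    refine (mem_range_grChart_iff I _).1 ⟨M, rfl⟩ v hv fun i hi => ?_
    by_cases hij : i = j.1
    · rw [hij, hvj]
    · exact herase i hi hij
  · rintro h ⟨I, M, rfl⟩
    -- The column of the last row has last entry `1`, so it does not lie in `E_n`.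
    have hcol := column_mem_grChart I.withLast M ⟨Fin.last n, I.last_mem_withLast⟩
    have h1 := eval_frameEntry_of_mem I.withLast.1 ⟨Fin.last n, I.last_mem_withLast⟩
      ⟨Fin.last n, I.last_mem_withLast⟩ M
    have h0 := mem_range_inclLast.1 (h hcol)
    rw [if_pos rfl] at h1
    exact zero_ne_one (h0.symm.trans h1)

end Homogenization

/-! ### The Grassmannian of the hyperplane `E_n` -/

section Hyperplane

variable {k n : ℕ}

/-- The map `Gr(k, n) → Gr(k, n + 1)` induced by the inclusion `ℝ^n ≅ E_n ⊆ ℝ^(n+1)`. -/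
def Gr.inclLast (B : Gr k n) : Gr k (n + 1) :=
  ⟨B.1.map (_root_.inclLast n),
    (Submodule.equivMapOfInjective _ inclLast_injective B.1).finrank_eq.symm.trans B.2⟩

theorem range_Gr_inclLast :
    Set.range (Gr.inclLast : Gr k n → Gr k (n + 1)) =
      {B : Gr k (n + 1) | B.1 ≤ LinearMap.range (inclLast n)} := by
  ext B
  constructor
  · rintro ⟨A, rfl⟩
    exact LinearMap.map_le_range
  · intro h
    have hB : (B.1.comap (inclLast n)).map (inclLast n) = B.1 := Submodule.map_comap_eq_of_le h
    refine ⟨⟨B.1.comap (inclLast n), ?_⟩, Subtype.ext hB⟩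
    rw [(Submodule.equivMapOfInjective _ inclLast_injective (B.1.comap (inclLast n))).finrank_eq,
      hB, B.2]

/-- In the charts, the last row of the normalized matrix vanishes. -/
theorem isChartwiseEmbedding_inclLast :
    SpaceWithFunctions.IsChartwiseEmbedding (fun I : RowSet k n => grChart I)
      (fun I : RowSet k (n + 1) => grChart I) Gr.inclLast RowSet.withoutLast
      (fun I c p => (I.withoutLastRow.symm p.1).elim 0 fun i => c (i, I.withoutLastCol.symm p.2))
      (fun I M p => M (I.withoutLastRow (some p.1), I.withoutLastCol p.2)) where
  injective A B h := by
    refine Subtype.ext (Submodule.map_injective_of_injective inclLast_injective ?_)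
    exact congrArg Subtype.val h
  cover := exists_mem_range_grChart
  isMorphism_map I := SpaceWithFunctions.isMorphism_of_eval fun p => by
    cases I.withoutLastRow.symm p.1 with
    | none => exact ⟨0, fun z => by simp⟩
    | some i => exact ⟨MvPolynomial.X (i, I.withoutLastCol.symm p.2), fun z => by simp⟩
  isMorphism_retraction I := SpaceWithFunctions.isMorphism_of_eval fun p =>
    ⟨MvPolynomial.X (I.withoutLastRow (some p.1), I.withoutLastCol p.2), fun z => by simp⟩
  retraction_map I c := by simp
  map_chart I c := by
    refine Subtype.ext (Submodule.ext fun w => ?_)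
    refine mem_map_inclLast.trans ?_
    rw [mem_grChart_withoutLast, mem_grChart]
    simp
  map_retraction I M h := by
    rw [range_Gr_inclLast] at h
    funext ⟨i, j⟩
    obtain ⟨i, rfl⟩ := I.withoutLastRow.surjective i
    obtain ⟨j, rfl⟩ := I.withoutLastCol.surjective j
    rcases i with _ | i
    · have h0 := mem_range_inclLast.1 (h (column_mem_grChart I.withoutLast M (I.withoutLastCol j)))
      have h1 := eval_frameEntry_of_notMem I.withoutLast.1 (I.withoutLastRow none)
        (I.withoutLastCol j) M
      rw [coe_optionCastSuccEquiv_none] at h1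
      simp [← h1, h0]
    · simp

end Hyperplane

theorem theorem5p1 (k n : ℕ) (hk : 0 < k) (hkn : k < n) :
    -- (i)
    ((graffVariety k n).IsAlgebraicVariety ∧ (graffVariety k n).IsIrreducibleVariety ∧
      (graffVariety k n).IsNonsingular) ∧
    ∃ j : Graff k n → Gr (k + 1) (n + 1),
      -- `j (A + b) = span (A ∪ {b + e_{n+1}})`
      (∀ (S : Graff k n) (b : Fin n → ℝ), b ∈ S.1 →
        (j S).1 = Submodule.span ℝ (inclLast n '' (S.1.direction : Set (Fin n → ℝ)) ∪
          {inclLast n b + Pi.single (Fin.last n) 1})) ∧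
      -- (ii)
      (graffVariety k n).IsVarietyEmbedding (grVariety (k + 1) (n + 1)) j ∧
      IsOpen[(grVariety (k + 1) (n + 1)).top] (Set.range j) ∧
      @Dense _ (grVariety (k + 1) (n + 1)).top (Set.range j) ∧
      @Topology.IsEmbedding _ _ (graffManifoldTopology k n)
        (grManifoldTopology (k + 1) (n + 1)) j ∧
      IsOpen[grManifoldTopology (k + 1) (n + 1)] (Set.range j) ∧
      @Dense _ (grManifoldTopology (k + 1) (n + 1)) (Set.range j) ∧
      -- (iii)
      (Set.range j)ᶜ = {B : Gr (k + 1) (n + 1) | B.1 ≤ LinearMap.range (inclLast n)} ∧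
      ∃ i : Gr (k + 1) n → Gr (k + 1) (n + 1),
        (∀ B : Gr (k + 1) n, (i B).1 = B.1.map (inclLast n)) ∧
        (grVariety (k + 1) n).IsVarietyEmbedding (grVariety (k + 1) (n + 1)) i ∧
        Set.range i = (Set.range j)ᶜ := by
  have hemb := isChartwiseEmbedding_homogenization (k := k) (n := n)
  have hatlas := hemb.isAtlas isAtlas_grChart
  obtain ⟨A, hA⟩ := exists_forall_mem_range_grChart (k := k + 1) (n := n + 1) (by lia)
  have hrange := hemb.range_eq fun I M => by simp
  obtain ⟨hemb_euclidean, hopen_euclidean⟩ :=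
    hemb.isOpenEmbedding_euclidean isAtlas_grChart fun I M => by simp
  obtain ⟨I₀, hI₀⟩ : ∃ I₀ : Finset (Fin n), I₀.card = k := by
    obtain ⟨s, -, hs⟩ := Finset.exists_subset_card_eq (s := (Finset.univ : Finset (Fin n)))
      (n := k) (by simpa using hkn.le)
    exact ⟨s, hs⟩
  -- The subspace `A` lies in all charts, in particular in one whose rows contain the last row.
  obtain ⟨S, rfl⟩ : A ∈ Set.range (homogenization : Graff k n → Gr (k + 1) (n + 1)) := by
    rw [hrange]
    exact Set.mem_iUnion.2 ⟨⟨I₀, hI₀⟩, hA _⟩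
  have hopen : IsOpen[(grVariety (k + 1) (n + 1)).top]
      (Set.range (homogenization : Graff k n → Gr (k + 1) (n + 1))) := by
    rw [hrange]
    let := (grVariety (k + 1) (n + 1)).top
    exact isOpen_iUnion fun I => isAtlas_grChart.isOpen_range I.withLast
  have hdense : @Dense _ (grVariety (k + 1) (n + 1)).top
      (Set.range (homogenization : Graff k n → Gr (k + 1) (n + 1))) := by
    let := (grVariety (k + 1) (n + 1)).top
    have : IrreducibleSpace (Gr (k + 1) (n + 1)) :=
      isIrreducibleVariety_grVariety (by lia)
    exact hopen.dense ⟨_, S, rfl⟩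
  refine ⟨⟨?_, ?_, hatlas.isNonsingular⟩, homogenization,
    fun S b hb => (homogenization_eq_cone S hb).trans (cone_eq_span _ _),
    hemb.isVarietyEmbedding isAtlas_grChart, hopen, hdense,
    hemb_euclidean, hopen_euclidean, isAtlas_grChart.dense_euclidean hopen hdense,
    compl_range_homogenization, Gr.inclLast, fun _ => rfl,
    isChartwiseEmbedding_inclLast.isVarietyEmbedding isAtlas_grChart,
    range_Gr_inclLast.trans compl_range_homogenization.symm⟩
  · exact hatlas.isAlgebraicVariety
      (isSeparatedSpace_grVariety.of_injective hemb.isMorphism homogenization_injective)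
  · refine hatlas.isIrreducibleVariety (x := S) fun I => ?_
    rw [← hemb.preimage_range]
    exact hA _
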